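/- **Definitions.** A *collage system* over an alphabet $\Sigma$ has finitely many nonterminals $X_1,\dots,X_m$, one of them the starting nonterminal, each with exactly one rule and deriving one string $\langle X\rangle$: - $X\to a$ (atomic, $a\in\Sigma$), $\langle X\rangle=a$; - $X\to YZ$ (concatenation), $\langle X\rangle=\langle Y\rangle\langle Z\rangle$; - $X\to Y^r$ with $r>2$ (repetition), $\langle X\rangle=\langle Y\rangle^r$; - $X\to Y[b..e)$ with $1\le b<e\le|\langle Y\rangle|+1$ (truncation), $\langle X\rangle=\langle Y\rangle[b..e)=\langle Y\rangle[b]\cdots\langle Y\rangle[e-1]$. Every rule refers to smaller nonterminals only, and every nonterminal is reached from the starting one. The system represents the string derived from its starting nonterminal. It is *internal* if for every nonterminal $X$ the starting nonterminal can be expanded, without using truncation rules, to a sequence containing $X$. The *binary parse tree* has a root labelled with the starting nonterminal. A node labelled $X$ has the single child $a$ if $X\to a$; the children $Y$, $Z$ if $X\to YZ$; the left child $Y$ and the right child $Y^{r-1}$ if $X\to Y^r$; and the single child $Y[b..e)$ if $X\to Y[b..e)$. Nodes labelled $a$, $Y^{r-1}$ or $Y[b..e)$ are leaves. The *grammar tree*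 is obtained by deleting all descendants of every node that is not the leftmost node with its label. The *ICS-factorization* of an internal collage system is the sequence of the strings derived from the leaves of its grammar tree, from left to right. A factorization of $T$ is a *valid ICS-factorization* if it is the ICS-factorization of some internal collage system representing $T$. **Lemma.** Let $T=F_1\cdots F_h$ be a factorization of a string $T$ into $h\ge1$ nonempty factors, and let $s_i=1+\sum_{k=1}^{i-1}|F_k|$ for $1\le i\le h+1$. The factorization is a valid ICS-factorization if and only if each factor $F_k$ with $|F_k|>1$ can be assigned one of the types (A), (B), (C) and indices $i_k,j_k\in\{1,\dots,h\}$ such that the following three conditions hold. (i) Each factor $F_k$ with $|F_k|>1$ satisfies, according to its type: - (A) $i_k\le j_k<k$ and $F_k=T[s_{i_k}..s_{j_k+1})$; - (B) $i_k\le j_k=k-1$ and $F_k=\bigl(T[s_{i_k}..s_{j_k+1})\bigr)^{r-1}$ for some integer $r\ge3$; - (C) $i_k\le j_k$, $k<i_k$ or $k>j_k$, and $F_k$ is a substring of $T[s_{i_k}..s_{j_k+1})$. (ii) Any two intervals in $I=I_1\cup I_2\cup I_3\cup I_4$ are disjoint or nested, where, with $k$ ranging over the indices with $|F_k|>1$,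 $I_1=\{[s_{i_k}..s_{j_k+1}) : F_k\text{ has type A}\}$, $I_2=\{[s_{i_k}..s_{j_k+1}) : F_k\text{ has type B}\}$, $I_3=\{[s_{i_k}..s_{k+1}) : F_k\text{ has type B}\}$, $I_4=\{[s_{i_k}..s_{j_k+1}) : F_k\text{ has type C}\}$. (iii) There are integers $D_1,\dots,D_h$ such that $D_k=0$ if $|F_k|=1$, and $D_k>\max\{D_{i_k},\dots,D_{j_k}\}$ if $|F_k|>1$. -/

import Mathlib

namespace Collage

/-! ### Strings -/

/-- The substring `w[b..e) = w[b] w[b+1] ⋯ w[e-1]`; positions are counted from `1`. -/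
def substr {α : Type*} (w : List α) (b e : ℕ) : List α := (w.drop (b - 1)).take (e - b)

/-- The `k`-fold repetition `w ^ k` of a string. -/
def power {α : Type*} (w : List α) (k : ℕ) : List α := (List.replicate k w).flatten

/-! ### Collage systems -/

/-- Right-hand sides of rules over terminals `α` and nonterminals `N`. -/
inductive Rule (α : Type*) (N : Type*)
  /-- `X → a` -/
  | atom (a : α)
  /-- `X → Y Z` -/
  | concat (Y Z : N)
  /-- `X → Y ^ r` -/
  | rep (Y : N) (r : ℕ)
  /-- `X → Y[b..e)` -/
  | trunc (Y : N) (b e : ℕ)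

/-- The nonterminal `W` occurs in the given right-hand side. -/
def Rule.RefersTo {α N : Type*} : Rule α N → N → Prop
  | .atom _, _ => False
  | .concat Y Z, W => W = Y ∨ W = Z
  | .rep Y _, W => W = Y
  | .trunc Y _ _, W => W = Y

/-- The raw data of a collage system: `m` nonterminals, one rule for each of them, and a starting
nonterminal. Nonterminals are sorted: a rule refers to smaller nonterminals only. -/
structure RuleSet (α : Type*) where
  m : ℕ
  rule : Fin m → Rule α (Fin m)
  start : Fin m
  refers_lt : ∀ X Y : Fin m, (rule X).RefersTo Y → Y < X

/-- The string `⟨X⟩` derived from the nonterminal `X`. -/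
def RuleSet.expand {α : Type*} (G : RuleSet α) (X : Fin G.m) : List α :=
  match h : G.rule X with
  | .atom a => [a]
  | .concat Y Z =>
    have : Y < X := G.refers_lt X Y (by simp [h, Rule.RefersTo])
    have : Z < X := G.refers_lt X Z (by simp [h, Rule.RefersTo])
    G.expand Y ++ G.expand Z
  | .rep Y r =>
    have : Y < X := G.refers_lt X Y (by simp [h, Rule.RefersTo])
    power (G.expand Y) r
  | .trunc Y b e =>
    have : Y < X := G.refers_lt X Y (by simp [h, Rule.RefersTo])
    substr (G.expand Y) b e
termination_by X

/-- A collage system: the side conditions on repetition and truncation rules hold, and there is no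
useless nonterminal, i.e. every nonterminal is reached from the starting nonterminal. -/
structure CollageSystem (α : Type*) extends RuleSet α where
  two_lt_of_rep : ∀ X Y r, rule X = .rep Y r → 2 < r
  bounds_of_trunc : ∀ X Y b e, rule X = .trunc Y b e →
    1 ≤ b ∧ b < e ∧ e ≤ (toRuleSet.expand Y).length + 1
  no_useless : ∀ X, Relation.ReflTransGen (fun V W => (rule V).RefersTo W) start X

/-- One expansion of one nonterminal in a sequence of terminals and nonterminals, by a rule that is
not a truncation rule. -/
inductive RuleSet.Step {α : Type*} (G : RuleSet α) :
    List (α ⊕ Fin G.m) → List (α ⊕ Fin G.m) → Prop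
  | atom (u v : List (α ⊕ Fin G.m)) (X : Fin G.m) (a : α) (h : G.rule X = .atom a) :
      RuleSet.Step G (u ++ [Sum.inr X] ++ v) (u ++ [Sum.inl a] ++ v)
  | concat (u v : List (α ⊕ Fin G.m)) (X Y Z : Fin G.m) (h : G.rule X = .concat Y Z) :
      RuleSet.Step G (u ++ [Sum.inr X] ++ v) (u ++ [Sum.inr Y, Sum.inr Z] ++ v)
  | rep (u v : List (α ⊕ Fin G.m)) (X Y : Fin G.m) (r : ℕ) (h : G.rule X = .rep Y r) :
      RuleSet.Step G (u ++ [Sum.inr X] ++ v) (u ++ List.replicate r (Sum.inr Y) ++ v)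

/-- A collage system is internal if, for every nonterminal `X`, the starting nonterminal can be
expanded, without using truncation rules, to a sequence that contains `X`. -/
def CollageSystem.Internal {α : Type*} (G : CollageSystem α) : Prop :=
  ∀ X : Fin G.m, ∃ w : List (α ⊕ Fin G.m),
    Relation.ReflTransGen G.toRuleSet.Step [Sum.inr G.start] w ∧ Sum.inr X ∈ w

/-! ### Parse trees -/

/-- Ordered labelled trees in which every node has at most two children. -/
inductive LTree (L : Type*)
  | leaf (l : L)
  | unary (l : L) (t : LTree L)
  | binary (l : L) (t₁ t₂ : LTree L)

/-- The labels of all nodes. -/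
def LTree.labels {L : Type*} : LTree L → Set L
  | .leaf l => {l}
  | .unary l t => {l} ∪ t.labels
  | .binary l t₁ t₂ => {l} ∪ t₁.labels ∪ t₂.labels

/-- The labels of the leaves, from left to right. -/
def LTree.leaves {L : Type*} : LTree L → List L
  | .leaf l => [l]
  | .unary _ t => t.leaves
  | .binary _ t₁ t₂ => t₁.leaves ++ t₂.leaves

open Classical in
/-- Delete all descendants of every node that has a node with the same label to its left, where
`S` is the set of the labels of the nodes to the left of the whole tree. -/
noncomputable def LTree.prune {L : Type*} (S : Set L) : LTree L → LTree L
  | .leaf l => .leaf l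
  | .unary l t => if l ∈ S then .leaf l else .unary l (t.prune S)
  | .binary l t₁ t₂ =>
    if l ∈ S then .leaf l else .binary l (t₁.prune S) (t₂.prune (S ∪ t₁.labels))

/-- Node labels of parse trees: `a`, `X`, `Y ^ k` and `Y[b..e)`. -/
inductive Label (α : Type*) (N : Type*)
  | term (a : α)
  | nonterm (X : N)
  | pow (Y : N) (k : ℕ)
  | sub (Y : N) (b e : ℕ)

/-- The string derived from a label. -/
def RuleSet.labelString {α : Type*} (G : RuleSet α) : Label α (Fin G.m) → List α
  | .term a => [a]
  | .nonterm X => G.expand X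
  | .pow Y k => power (G.expand Y) k
  | .sub Y b e => substr (G.expand Y) b e

/-- The binary parse tree below a node with label `X`. -/
def RuleSet.parseTree {α : Type*} (G : RuleSet α) (X : Fin G.m) : LTree (Label α (Fin G.m)) :=
  match h : G.rule X with
  | .atom a => .unary (.nonterm X) (.leaf (.term a))
  | .concat Y Z =>
    have : Y < X := G.refers_lt X Y (by simp [h, Rule.RefersTo])
    have : Z < X := G.refers_lt X Z (by simp [h, Rule.RefersTo])
    .binary (.nonterm X) (G.parseTree Y) (G.parseTree Z)
  | .rep Y r =>
    have : Y < X := G.refers_lt X Y (by simp [h, Rule.RefersTo])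
    .binary (.nonterm X) (G.parseTree Y) (.leaf (.pow Y (r - 1)))
  | .trunc Y b e => .unary (.nonterm X) (.leaf (.sub Y b e))
termination_by X

/-- The grammar tree: the binary parse tree of the starting nonterminal, with all descendants
deleted under any node that is not the leftmost node with its label. -/
noncomputable def RuleSet.grammarTree {α : Type*} (G : RuleSet α) : LTree (Label α (Fin G.m)) :=
  (G.parseTree G.start).prune ∅

/-- The strings derived from the leaves of the grammar tree, from left to right. -/
noncomputable def RuleSet.leafStrings {α : Type*} (G : RuleSet α) : List (List α) :=
  G.grammarTree.leaves.map G.labelString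

/-- `F` is the factorization given by the grammar tree of some internal collage system for `T`. -/
def IsICSFactorization {α : Type*} (T : List α) (F : List (List α)) : Prop :=
  ∃ G : CollageSystem α, G.Internal ∧ G.expand G.start = T ∧ G.leafStrings = F

/-! ### Reference structures of factorizations

Factors are indexed from `0`: `F[k]` is the factor `F_{k+1}` of the usual numbering. -/

/-- The (1-based) position in `F.flatten` at which `F[k]` starts; for `k = F.length` it is the
position after the last one. -/
def startPos {α : Type*} (F : List (List α)) (k : ℕ) : ℕ := 1 + ((F.take k).map List.length).sum

/-- The substring `F[i] ⋯ F[j]` of `T`, cut out by positions. -/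
def factorRange {α : Type*} (T : List α) (F : List (List α)) (i j : ℕ) : List α :=
  substr T (startPos F i) (startPos F (j + 1))

/-- The interval of the positions covered by `F[i] ⋯ F[j]`. -/
def posInterval {α : Type*} (F : List (List α)) (i j : ℕ) : Set ℕ :=
  Set.Ico (startPos F i) (startPos F (j + 1))

/-- The three types of factors: copy, repetition, truncation. -/
inductive FactorType
  | A
  | B
  | C

/-- The factor `F[k]` of the given type matches its reference `F[i] ⋯ F[j]`. -/
def Matches {α : Type*} (T : List α) (F : List (List α)) (k i j : Fin F.length) :
    FactorType → Prop
  | .A => i ≤ j ∧ j < k ∧ F[k] = factorRange T F i j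
  | .B => i ≤ j ∧ (j : ℕ) + 1 = k ∧ ∃ r : ℕ, 3 ≤ r ∧ F[k] = power (factorRange T F i j) (r - 1)
  | .C => i ≤ j ∧ (k < i ∨ j < k) ∧ F[k] <:+: factorRange T F i j

/-- The set of intervals induced by types `ty` and references `i k, …, j k` of the factors longer
than `1`: all reference intervals, and for a repetition also its union with its reference. -/
def inducedIntervals {α : Type*} (F : List (List α)) (ty : Fin F.length → FactorType)
    (i j : Fin F.length → Fin F.length) : Set (Set ℕ) :=
  {S | ∃ k, 1 < F[k].length ∧ ty k = .A ∧ S = posInterval F (i k) (j k)} ∪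
  {S | ∃ k, 1 < F[k].length ∧ ty k = .B ∧ S = posInterval F (i k) (j k)} ∪
  {S | ∃ k, 1 < F[k].length ∧ ty k = .B ∧ S = posInterval F (i k) k} ∪
  {S | ∃ k, 1 < F[k].length ∧ ty k = .C ∧ S = posInterval F (i k) (j k)}

/-- Compatibility with a tree: any two members are disjoint or nested. -/
def Laminar (I : Set (Set ℕ)) : Prop :=
  ∀ S ∈ I, ∀ S' ∈ I, Disjoint S S' ∨ S ⊆ S' ∨ S' ⊆ S

/-- Reference depths: `0` for factors of length `1`, and larger than all the depths of the factors
referred to for the longer ones. -/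
def IsReferenceDepth {α : Type*} (F : List (List α)) (i j : Fin F.length → Fin F.length)
    (D : Fin F.length → ℤ) : Prop :=
  (∀ k, F[k].length = 1 → D k = 0) ∧
  (∀ k, 1 < F[k].length → ∀ l, i k ≤ l → l ≤ j k → D l < D k)

end Collage

/-! Both directions go through `Refs`, the combinatorial data rewritten with factor indices and
half-open ranges instead of text positions.

From a collage system to references (`CollageSystem.Internal.exists_ref`): a leaf longer than one
symbol is labelled `X`, `Y^(r-1)` or `Y[b..e)`. A leaf `X` refers to the leaves below an unpruned
occurrence of `X` to its left, a leaf `Y^(r-1)` to the leaves below its left sibling, and a leaf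
`Y[b..e)` to those below an unpruned occurrence of `Y`, which exists because the system is internal.
All the intervals are leaf sets of subtrees of one tree, hence laminar (`SubAt.compat`). Rules refer
to smaller nonterminals, so the number of the nonterminal in the label gives a reference depth
(`RuleSet.depth_leaves_prune`).

From references to a collage system: laminarity lets all the intervals occur as nodes of one binary
tree over the factors (`Node.of_compat`). A node becomes a nonterminal unless it is the leaf of a
repetition factor; a copy shares the nonterminal of its reference. For this no reference may be a
single repetition factor, which `Refs.exists_normalized` arranges. An interval with its repetition
factor gets a repetition rule, a leaf of type C a truncation rule, a short leaf an atomic rule, and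
the other inner nodes concatenations.

Truncations may refer to the right, so the order of the nonterminals cannot come from positions. It
comes from `rank`, which compares intervals first by maximal reference depth and then by length
(`Refs.exists_realizes`). The tree edges avoid truncations, which makes the system internal
(`Realizes.reach`). Finally, a left-to-right traversal in which the labels already seen are exactly
those of main nodes ending at or before the current position recovers the factors as leaves
(`Realizes.leaves_prune`). -/

namespace Collage

/-! ### Factor ranges and positions. -/

variable {α : Type*}

/-- The concatenation of the factors with indices in `[a, b)`. -/
def seg (F : List (List α)) (a b : ℕ) : List α := ((F.drop a).take (b - a)).flatten

/-- The factor with index `k` exists and has length at least two. -/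
def Long (F : List (List α)) (k : ℕ) : Prop := 1 < (F.getD k []).length

theorem Long.lt_length {F : List (List α)} {k : ℕ} (h : Long F k) : k < F.length := by
  by_contra hk
  rw [Long, List.getD_eq_default _ _ (not_lt.mp hk)] at h
  simp at h

theorem drop_take_append {β : Type*} (l : List β) {a b c : ℕ} (hab : a ≤ b) (hbc : b ≤ c) :
    (l.drop a).take (b - a) ++ (l.drop b).take (c - b) = (l.drop a).take (c - a) := by
  have h : l.drop b = (l.drop a).drop (b - a) := by
    rw [List.drop_drop]; congr 1; omega
  rw [h, ← List.take_add]
  congr 1; omega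

theorem drop_take_single (F : List (List α)) {k : ℕ} (hk : k < F.length) :
    (F.drop k).take (k + 1 - k) = [F.getD k []] := by
  rw [Nat.add_sub_cancel_left, List.drop_eq_getElem_cons hk, List.getD_eq_getElem _ _ hk,
    List.take_succ_cons, List.take_zero]

theorem seg_append (F : List (List α)) {a b c : ℕ} (hab : a ≤ b) (hbc : b ≤ c) :
    seg F a b ++ seg F b c = seg F a c := by
  rw [seg, seg, seg, ← List.flatten_append, drop_take_append F hab hbc]

theorem seg_single (F : List (List α)) {k : ℕ} (hk : k < F.length) :
    seg F k (k + 1) = F.getD k [] := by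
  rw [seg, drop_take_single F hk, List.flatten_singleton]

theorem seg_full (F : List (List α)) : seg F 0 F.length = F.flatten := by
  simp [seg]

theorem startPos_eq (F : List (List α)) (k : ℕ) : startPos F k = 1 + (seg F 0 k).length := by
  simp [startPos, seg, List.length_flatten]

theorem length_seg_pos {F : List (List α)} (hne : ∀ w ∈ F, w ≠ []) {a b : ℕ} (hab : a < b)
    (hb : b ≤ F.length) : 0 < (seg F a b).length := by
  rw [← seg_append F (Nat.le_succ a) hab, seg_single F (by omega), List.length_append,
    List.getD_eq_getElem _ _ (by omega)]
  have := List.length_pos_iff.mpr (hne _ (List.getElem_mem (show a < F.length by omega)))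
  omega

theorem startPos_lt {F : List (List α)} (hne : ∀ w ∈ F, w ≠ []) {a b : ℕ} (hab : a < b)
    (hb : b ≤ F.length) : startPos F a < startPos F b := by
  have := length_seg_pos hne hab hb
  rw [startPos_eq, startPos_eq, ← seg_append F (Nat.zero_le a) hab.le, List.length_append]
  omega

theorem startPos_le_iff {F : List (List α)} (hne : ∀ w ∈ F, w ≠ []) {a b : ℕ}
    (ha : a ≤ F.length) (hb : b ≤ F.length) : startPos F a ≤ startPos F b ↔ a ≤ b := by
  constructor
  · intro h
    by_contra hab
    exact absurd (startPos_lt hne (not_le.mp hab) ha) (not_lt.mpr h)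
  · intro h
    rcases h.eq_or_lt with rfl | h
    · exact le_rfl
    · exact (startPos_lt hne h hb).le

theorem substr_startPos (F : List (List α)) {a b : ℕ} (hab : a ≤ b) :
    substr F.flatten (startPos F a) (startPos F b) = seg F a b := by
  by_cases hb : b ≤ F.length
  · have h1 : F.flatten = seg F 0 a ++ (seg F a b ++ seg F b F.length) := by
      rw [seg_append F hab hb, seg_append F (Nat.zero_le a) (hab.trans hb), seg_full]
    have h2 := congrArg List.length (seg_append F (Nat.zero_le a) hab)
    rw [List.length_append] at h2
    rw [substr, startPos_eq, startPos_eq, h1, Nat.add_sub_cancel_left, List.drop_left,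
      show 1 + (seg F 0 b).length - (1 + (seg F 0 a).length) = (seg F a b).length by omega,
      List.take_left]
  -- Beyond the last factor both `seg` and `startPos` are constant in the right end.
  · have hs : ∀ c, F.length ≤ c → ∀ a, seg F a c = seg F a F.length := by
      intro c hc a
      rw [seg, seg, List.take_of_length_le (by simp; omega),
        List.take_of_length_le (by simp)]
    have h2 := startPos_eq F b
    rw [hs b (by omega), seg_full] at h2
    rw [hs b (by omega), h2]
    rcases le_total a F.length with ha | ha
    · have h1 : F.flatten = seg F 0 a ++ seg F a F.length := by
        rw [seg_append F (Nat.zero_le a) ha, seg_full]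
      rw [substr, startPos_eq, h1, Nat.add_sub_cancel_left, List.drop_left, List.length_append,
        List.take_of_length_le (by omega)]
    · rw [substr, startPos_eq, hs a ha, seg_full]
      simp [seg, List.drop_eq_nil_of_le ha]

/-- `[x, y)` is the reference of a long factor, or the union of a repetition factor with its
reference. -/
def IsRef (F : List (List α)) (ty : ℕ → FactorType) (i j : ℕ → ℕ) (x y : ℕ) : Prop :=
  ∃ k, Long F k ∧ x = i k ∧ (y = j k ∨ ty k = .B ∧ y = k + 1)

/-- `[a, b)` and `[c, d)` are disjoint or nested. -/
def Compat (a b c d : ℕ) : Prop := b ≤ c ∨ d ≤ a ∨ (a ≤ c ∧ d ≤ b) ∨ (c ≤ a ∧ b ≤ d)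

/-- A reference structure: long factors have types, references `[i k, j k)` and depths. -/
structure Refs (F : List (List α)) (ty : ℕ → FactorType) (i j D : ℕ → ℕ) : Prop where
  lt : ∀ k, Long F k → i k < j k ∧ j k ≤ F.length
  copy : ∀ k, Long F k → ty k = .A → j k ≤ k ∧ F.getD k [] = seg F (i k) (j k)
  rep : ∀ k, Long F k → ty k = .B →
    j k = k ∧ ∃ r, 3 ≤ r ∧ F.getD k [] = power (seg F (i k) (j k)) (r - 1)
  trunc : ∀ k, Long F k → ty k = .C → (k < i k ∨ j k ≤ k) ∧ F.getD k [] <:+: seg F (i k) (j k)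
  compat : ∀ a b c d, IsRef F ty i j a b → IsRef F ty i j c d → Compat a b c d
  depth_zero : ∀ k, ¬ Long F k → D k = 0
  depth_lt : ∀ k, Long F k → ∀ l, i k ≤ l → l < j k → D l < D k

/-! ### Passage between the two forms of reference structures. -/

theorem long_iff (F : List (List α)) (k : Fin F.length) : Long F k ↔ 1 < F[k].length := by
  simp [Long]

/-- As factors are nonempty, `startPos` is strictly increasing up to `F.length`, so laminarity can
be tested on indices. -/
theorem compat_iff {F : List (List α)} (hne : ∀ w ∈ F, w ≠ []) {a b c d : ℕ}
    (hab : a < b) (hb : b ≤ F.length) (hcd : c < d) (hd : d ≤ F.length) :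
    (Disjoint (Set.Ico (startPos F a) (startPos F b)) (Set.Ico (startPos F c) (startPos F d)) ∨
      Set.Ico (startPos F a) (startPos F b) ⊆ Set.Ico (startPos F c) (startPos F d) ∨
      Set.Ico (startPos F c) (startPos F d) ⊆ Set.Ico (startPos F a) (startPos F b)) ↔
      Compat a b c d := by
  have hab' := startPos_lt hne hab hb
  have hcd' := startPos_lt hne hcd hd
  rw [Set.Ico_subset_Ico_iff hab', Set.Ico_subset_Ico_iff hcd', Set.Ico_disjoint_Ico, min_le_iff,
    le_max_iff, le_max_iff]
  have e1 := startPos_le_iff hne hb (show a ≤ F.length by omega)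
  have e2 := startPos_le_iff hne hb (show c ≤ F.length by omega)
  have e3 := startPos_le_iff hne hd (show a ≤ F.length by omega)
  have e4 := startPos_le_iff hne hd (show c ≤ F.length by omega)
  have e5 := startPos_le_iff hne (show a ≤ F.length by omega) (show c ≤ F.length by omega)
  have e6 := startPos_le_iff hne (show c ≤ F.length by omega) (show a ≤ F.length by omega)
  have e7 := startPos_le_iff hne hb hd
  have e8 := startPos_le_iff hne hd hb
  rw [e1, e2, e3, e4, e5, e6, e7, e8, Compat]
  omega

theorem mem_inducedIntervals {F : List (List α)} {ty : Fin F.length → FactorType}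
    {i j : Fin F.length → Fin F.length} {S : Set ℕ} :
    S ∈ inducedIntervals F ty i j ↔ ∃ k : Fin F.length, 1 < F[k].length ∧
      (S = posInterval F (i k) (j k) ∨ ty k = .B ∧ S = posInterval F (i k) k) := by
  simp only [inducedIntervals, Set.mem_union, Set.mem_ofPred_eq]
  constructor
  · rintro (((⟨k, h, -, rfl⟩ | ⟨k, h, -, rfl⟩) | ⟨k, h, h', rfl⟩) | ⟨k, h, -, rfl⟩)
    exacts [⟨k, h, .inl rfl⟩, ⟨k, h, .inl rfl⟩, ⟨k, h, .inr ⟨h', rfl⟩⟩, ⟨k, h, .inl rfl⟩]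
  · rintro ⟨k, h, rfl | ⟨h', rfl⟩⟩
    · rcases hk : ty k
      exacts [.inl (.inl (.inl ⟨k, h, hk, rfl⟩)), .inl (.inl (.inr ⟨k, h, hk, rfl⟩)),
        .inr ⟨k, h, hk, rfl⟩]
    · exact .inl (.inr ⟨k, h, h', rfl⟩)

/-- A factor of minimal depth cannot be long, since its reference would be shallower; so the minimum
is the depth `0` of a short factor. This allows natural-number depths. -/
theorem IsReferenceDepth.nonneg {F : List (List α)} (hne : ∀ w ∈ F, w ≠ [])
    {i j : Fin F.length → Fin F.length} (hij : ∀ k, 1 < F[k].length → i k ≤ j k)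
    {D : Fin F.length → ℤ} (hD : IsReferenceDepth F i j D) (k : Fin F.length) : 0 ≤ D k := by
  obtain ⟨k₀, -, hk₀⟩ := Finset.exists_min_image Finset.univ D ⟨k, Finset.mem_univ k⟩
  refine le_trans ?_ (hk₀ k (Finset.mem_univ k))
  by_cases hl : 1 < F[k₀].length
  · exact absurd (hD.2 k₀ hl (i k₀) le_rfl (hij k₀ hl))
      (not_lt.mpr (hk₀ _ (Finset.mem_univ _)))
  · have := List.length_pos_iff.mpr (hne _ (List.getElem_mem k₀.2))
    rw [hD.1 k₀ (by simp at hl this ⊢; omega)]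

theorem exists_refs_of_fin {T : List α} {F : List (List α)} (hT : T = F.flatten)
    (hne : ∀ w ∈ F, w ≠ []) {ty : Fin F.length → FactorType} {i j : Fin F.length → Fin F.length}
    (hM : ∀ k, 1 < F[k].length → Matches T F k (i k) (j k) (ty k))
    (hL : Laminar (inducedIntervals F ty i j)) {D : Fin F.length → ℤ}
    (hD : IsReferenceDepth F i j D) : ∃ ty i j D, Refs F ty i j D := by
  subst hT
  have hij : ∀ k, 1 < F[k].length → i k ≤ j k := by
    intro k hk
    have := hM k hk
    rcases hty : ty k <;> rw [hty] at this <;> exact this.1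
  have hnn := hD.nonneg hne hij
  refine ⟨fun k => if h : k < F.length then ty ⟨k, h⟩ else .A,
    fun k => if h : k < F.length then i ⟨k, h⟩ else 0,
    -- Inclusive right ends become exclusive. Indices out of range are not `Long`, so their values
    -- matter only for the depth, where `depth_zero` asks for `0`.
    fun k => if h : k < F.length then j ⟨k, h⟩ + 1 else 0,
    fun k => if h : k < F.length then (D ⟨k, h⟩).toNat else 0, ?_⟩
  have hseg : ∀ k : Fin F.length, 1 < F[k].length →
      factorRange F.flatten F (i k) (j k) = seg F (i k) (j k + 1) := fun k hk =>
    substr_startPos F (by have := hij k hk; rw [Fin.le_def] at this; omega)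
  constructor
  · intro k hk
    have hk' := hk.lt_length
    have := hij ⟨k, hk'⟩ ((long_iff F ⟨k, hk'⟩).mp hk)
    rw [Fin.le_def] at this
    simp only [hk', dif_pos]
    omega
  · intro k hk
    have hk' := hk.lt_length
    have hl := (long_iff F ⟨k, hk'⟩).mp hk
    simp only [hk', dif_pos]
    intro hty
    have h := hM _ hl
    rw [hty] at h
    obtain ⟨-, h2, h3⟩ := h
    rw [hseg _ hl] at h3
    rw [Fin.lt_def] at h2
    exact ⟨h2, by rw [List.getD_eq_getElem _ _ hk']; exact h3⟩
  · intro k hk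
    have hk' := hk.lt_length
    have hl := (long_iff F ⟨k, hk'⟩).mp hk
    simp only [hk', dif_pos]
    intro hty
    have h := hM _ hl
    rw [hty] at h
    obtain ⟨-, h2, r, hr, h3⟩ := h
    rw [hseg _ hl] at h3
    exact ⟨h2, r, hr, by rw [List.getD_eq_getElem _ _ hk']; exact h3⟩
  · intro k hk
    have hk' := hk.lt_length
    have hl := (long_iff F ⟨k, hk'⟩).mp hk
    simp only [hk', dif_pos]
    intro hty
    have h := hM _ hl
    rw [hty] at h
    obtain ⟨-, h2, h3⟩ := h
    rw [hseg _ hl] at h3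
    rw [Fin.lt_def, Fin.lt_def] at h2
    exact ⟨h2, by rw [List.getD_eq_getElem _ _ hk']; exact h3⟩
  · have key : ∀ a b, IsRef F (fun k => if h : k < F.length then ty ⟨k, h⟩ else .A)
        (fun k => if h : k < F.length then i ⟨k, h⟩ else 0)
        (fun k => if h : k < F.length then j ⟨k, h⟩ + 1 else 0) a b →
        a < b ∧ b ≤ F.length ∧
          Set.Ico (startPos F a) (startPos F b) ∈ inducedIntervals F ty i j := by
      rintro a b ⟨k, hk, rfl, h⟩
      have hk' := hk.lt_length
      have hl := (long_iff F ⟨k, hk'⟩).mp hk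
      have hle := hij _ hl
      rw [Fin.le_def] at hle
      simp only [hk', dif_pos] at h ⊢
      rw [mem_inducedIntervals]
      rcases h with rfl | ⟨hty, rfl⟩
      · exact ⟨by omega, by omega, _, hl, .inl rfl⟩
      · have h := hM _ hl
        rw [hty] at h
        have h2 := h.2.1
        simp only at h2
        exact ⟨by omega, by omega, _, hl, .inr ⟨hty, rfl⟩⟩
    intro a b c d h1 h2
    obtain ⟨p1, p2, p3⟩ := key a b h1
    obtain ⟨q1, q2, q3⟩ := key c d h2
    exact (compat_iff hne p1 p2 q1 q2).mp (hL _ p3 _ q3)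
  · intro k hk
    by_cases hk' : k < F.length
    · have hl := (long_iff F ⟨k, hk'⟩).not.mp hk
      have := List.length_pos_iff.mpr (hne _ (List.getElem_mem hk'))
      simp only [hk', dif_pos]
      rw [hD.1 ⟨k, hk'⟩ (by simp at hl this ⊢; omega)]
      rfl
    · simp [hk']
  · intro k hk l
    have hk' := hk.lt_length
    have hl := (long_iff F ⟨k, hk'⟩).mp hk
    simp only [hk', dif_pos]
    intro h1 h2
    have hl' : l < F.length := by omega
    simp only [hl', dif_pos]
    have := hD.2 _ hl ⟨l, hl'⟩ h1 (Nat.lt_succ_iff.mp h2)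
    have := hnn ⟨l, hl'⟩
    omega

theorem Refs.exists_fin {T : List α} {F : List (List α)} (hT : T = F.flatten)
    (hne : ∀ w ∈ F, w ≠ []) {ty : ℕ → FactorType} {i j D : ℕ → ℕ} (hR : Refs F ty i j D) :
    ∃ (ty : Fin F.length → FactorType) (i j : Fin F.length → Fin F.length),
      (∀ k, 1 < F[k].length → Matches T F k (i k) (j k) (ty k)) ∧
      Laminar (inducedIntervals F ty i j) ∧
      ∃ D : Fin F.length → ℤ, IsReferenceDepth F i j D := by
  subst hT
  classical
  have hi : ∀ k : Fin F.length, Long F k → i k < F.length := fun k hk => by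
    have := hR.lt k hk; omega
  have hj : ∀ k : Fin F.length, Long F k → j k - 1 < F.length := fun k hk => by
    have := hR.lt k hk; omega
  refine ⟨fun k => ty k, fun k => if h : Long F k then ⟨i k, hi k h⟩ else k,
    fun k => if h : Long F k then ⟨j k - 1, hj k h⟩ else k, ?_, ?_, fun k => (D k : ℤ), ?_, ?_⟩
  · intro k hk
    have hl := (long_iff F k).mpr hk
    simp only [hl, dif_pos]
    have hlt := hR.lt k hl
    have hjj : j k - 1 + 1 = j k := by omega
    have hseg : factorRange F.flatten F (i k) (j k - 1) = seg F (i k) (j k) := by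
      rw [factorRange, hjj, substr_startPos F hlt.1.le]
    have hget : F[k] = F.getD k [] := (List.getD_eq_getElem _ _ k.2).symm
    rcases hty : ty k
    · obtain ⟨h1, h2⟩ := hR.copy k hl hty
      refine ⟨?_, ?_, ?_⟩
      · rw [Fin.le_def]; simp only; omega
      · rw [Fin.lt_def]; simp only; omega
      · rw [hget, h2]; exact hseg.symm
    · obtain ⟨h1, r, hr, h2⟩ := hR.rep k hl hty
      refine ⟨?_, ?_, r, hr, ?_⟩
      · rw [Fin.le_def]; simp only; omega
      · simp only; omega
      · rw [hget, h2]; simp only; rw [hseg]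
    · obtain ⟨h1, h2⟩ := hR.trunc k hl hty
      refine ⟨?_, ?_, ?_⟩
      · rw [Fin.le_def]; simp only; omega
      · rw [Fin.lt_def, Fin.lt_def]; simp only; omega
      · rw [hget]; simp only; rw [hseg]; exact h2
  · have key : ∀ S ∈ inducedIntervals F (fun k => ty k)
        (fun k => if h : Long F k then ⟨i k, hi k h⟩ else k)
        (fun k => if h : Long F k then ⟨j k - 1, hj k h⟩ else k),
        ∃ a b, a < b ∧ b ≤ F.length ∧ IsRef F ty i j a b ∧
          S = Set.Ico (startPos F a) (startPos F b) := by
      intro S hS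
      obtain ⟨k, hk, h⟩ := mem_inducedIntervals.mp hS
      have hl := (long_iff F k).mpr hk
      simp only [hl, dif_pos] at h
      have hlt := hR.lt k hl
      have hjj : j k - 1 + 1 = j k := by omega
      rcases h with rfl | ⟨hty, rfl⟩
      · exact ⟨i k, j k, hlt.1, hlt.2, ⟨k, hl, rfl, .inl rfl⟩, by rw [posInterval, hjj]⟩
      · have := (hR.rep k hl hty).1
        exact ⟨i k, k + 1, by omega, by omega, ⟨k, hl, rfl, .inr ⟨hty, rfl⟩⟩, rfl⟩
    intro S hS S' hS'
    obtain ⟨a, b, hab, hb, h1, rfl⟩ := key S hS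
    obtain ⟨c, d, hcd, hd, h2, rfl⟩ := key S' hS'
    exact (compat_iff hne hab hb hcd hd).mpr (hR.compat _ _ _ _ h1 h2)
  · intro k hk
    have : ¬ Long F k := by rw [long_iff, hk]; simp
    exact Int.ofNat_eq_zero.mpr (hR.depth_zero k this)
  · intro k hk l
    have hl := (long_iff F k).mpr hk
    simp only [hl, dif_pos]
    intro h1 h2
    rw [Fin.le_def] at h1 h2
    have hlt := hR.lt k hl
    simp only at h1 h2
    exact_mod_cast hR.depth_lt k hl l h1 (by omega)

/-! ### Derived strings and parse trees, rule by rule. -/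

theorem RuleSet.expand_atom {G : RuleSet α} {X : Fin G.m} {a : α} (h : G.rule X = .atom a) :
    G.expand X = [a] := by
  rw [RuleSet.expand]; split <;> simp_all

theorem RuleSet.expand_concat {G : RuleSet α} {X Y Z : Fin G.m} (h : G.rule X = .concat Y Z) :
    G.expand X = G.expand Y ++ G.expand Z := by
  rw [RuleSet.expand]; split <;> simp_all

theorem RuleSet.expand_rep {G : RuleSet α} {X Y : Fin G.m} {r : ℕ} (h : G.rule X = .rep Y r) :
    G.expand X = power (G.expand Y) r := by
  rw [RuleSet.expand]; split <;> simp_all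

theorem RuleSet.expand_trunc {G : RuleSet α} {X Y : Fin G.m} {b e : ℕ}
    (h : G.rule X = .trunc Y b e) :
    G.expand X = substr (G.expand Y) b e := by
  rw [RuleSet.expand]; split <;> simp_all

theorem RuleSet.parseTree_atom {G : RuleSet α} {X : Fin G.m} {a : α} (h : G.rule X = .atom a) :
    G.parseTree X = .unary (.nonterm X) (.leaf (.term a)) := by
  rw [RuleSet.parseTree]; split <;> simp_all

theorem RuleSet.parseTree_concat {G : RuleSet α} {X Y Z : Fin G.m} (h : G.rule X = .concat Y Z) :
    G.parseTree X = .binary (.nonterm X) (G.parseTree Y) (G.parseTree Z) := by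
  rw [RuleSet.parseTree]; split <;> simp_all

theorem RuleSet.parseTree_rep {G : RuleSet α} {X Y : Fin G.m} {r : ℕ} (h : G.rule X = .rep Y r) :
    G.parseTree X = .binary (.nonterm X) (G.parseTree Y) (.leaf (.pow Y (r - 1))) := by
  rw [RuleSet.parseTree]; split <;> simp_all

theorem RuleSet.parseTree_trunc {G : RuleSet α} {X Y : Fin G.m} {b e : ℕ}
    (h : G.rule X = .trunc Y b e) :
    G.parseTree X = .unary (.nonterm X) (.leaf (.sub Y b e)) := by
  rw [RuleSet.parseTree]; split <;> simp_all

theorem power_succ (w : List α) (k : ℕ) : power w (k + 1) = w ++ power w k := by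
  simp [power, List.replicate_succ]

theorem power_pred (w : List α) {r : ℕ} (hr : 2 < r) : power w r = w ++ power w (r - 1) := by
  rw [← power_succ, Nat.sub_add_cancel (by omega)]

@[elab_as_elim]
theorem RuleSet.induction (G : RuleSet α) {motive : Fin G.m → Prop}
    (atom : ∀ X a, G.rule X = .atom a → motive X)
    (concat : ∀ X Y Z, G.rule X = .concat Y Z → Y < X → Z < X → motive Y → motive Z → motive X)
    (rep : ∀ X Y r, G.rule X = .rep Y r → Y < X → motive Y → motive X)
    (trunc : ∀ X Y b e, G.rule X = .trunc Y b e → Y < X → motive Y → motive X)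
    (X : Fin G.m) : motive X := by
  induction X using WellFoundedLT.induction with
  | ind X ih =>
    rcases h : G.rule X with a | ⟨Y, Z⟩ | ⟨Y, r⟩ | ⟨Y, b, e⟩
    · exact atom X a h
    · have hY := G.refers_lt X Y (by simp [h, Rule.RefersTo])
      have hZ := G.refers_lt X Z (by simp [h, Rule.RefersTo])
      exact concat X Y Z h hY hZ (ih Y hY) (ih Z hZ)
    · have hY := G.refers_lt X Y (by simp [h, Rule.RefersTo])
      exact rep X Y r h hY (ih Y hY)
    · have hY := G.refers_lt X Y (by simp [h, Rule.RefersTo])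
      exact trunc X Y b e h hY (ih Y hY)

/-! ### Occurrences of subtrees and their leaf intervals. -/

/-- The subtree `s` occurs in `t`; the leaves of `t` are numbered from `o` on, those of `s` from
`a` on. -/
inductive SubAt {L : Type*} : LTree L → ℕ → LTree L → ℕ → Prop
  | refl (t o) : SubAt t o t o
  | unary {l t o s a} : SubAt t o s a → SubAt (.unary l t) o s a
  | left {l t₁ t₂ o s a} : SubAt t₁ o s a → SubAt (.binary l t₁ t₂) o s a
  | right {l t₁ t₂ o s a} :
      SubAt t₂ (o + t₁.leaves.length) s a → SubAt (.binary l t₁ t₂) o s a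

section Trees

variable {L : Type*}

theorem LTree.length_leaves_pos (t : LTree L) : 0 < t.leaves.length := by
  induction t with
  | leaf l => simp [LTree.leaves]
  | unary l t ih => exact ih
  | binary l t₁ t₂ ih₁ ih₂ => simp only [LTree.leaves, List.length_append]; omega

theorem SubAt.bounds {t s : LTree L} {o a : ℕ} (h : SubAt t o s a) :
    o ≤ a ∧ a + s.leaves.length ≤ o + t.leaves.length := by
  induction h with
  | refl => simp
  | unary _ ih => exact ih
  | left _ ih => simp only [LTree.leaves, List.length_append]; omega
  | right _ ih => simp only [LTree.leaves, List.length_append]; omega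

theorem SubAt.leaves_eq {t s : LTree L} {o a : ℕ} (h : SubAt t o s a) :
    s.leaves = (t.leaves.drop (a - o)).take s.leaves.length := by
  induction h with
  | refl => simp
  | unary _ ih => exact ih
  | left h ih =>
    have := h.bounds
    rw [LTree.leaves, List.drop_append_of_le_length (by omega),
      List.take_append_of_le_length (by simp; omega)]
    exact ih
  | @right l t₁ t₂ o s a h ih =>
    have := h.bounds
    rw [LTree.leaves, List.drop_append, List.drop_eq_nil_of_le (by omega), List.nil_append,
      Nat.sub_sub]
    exact ih

/-- Two nodes either lie one below the other or are separated at a branching. This is the source of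
laminarity. -/
theorem SubAt.compat {t s s' : LTree L} {o a a' : ℕ} (h : SubAt t o s a) (h' : SubAt t o s' a') :
    Compat a (a + s.leaves.length) a' (a' + s'.leaves.length) := by
  induction h with
  | refl => have := h'.bounds; exact .inr (.inr (.inl this))
  | unary h ih =>
    cases h' with
    | refl => have := h.bounds; exact .inr (.inr (.inr this))
    | unary h' => exact ih h'
  | left h ih =>
    cases h' with
    | refl => exact .inr (.inr (.inr (SubAt.left h).bounds))
    | left h' => exact ih h'
    | right h' => have := h.bounds; have := h'.bounds; exact .inl (by omega)
  | right h ih =>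
    cases h' with
    | refl => exact .inr (.inr (.inr (SubAt.right h).bounds))
    | left h' => have := h.bounds; have := h'.bounds; exact .inr (.inl (by omega))
    | right h' => exact ih h'

theorem LTree.exists_subAt_leaf (t : LTree L) (o : ℕ) {k : ℕ} (hk : k < t.leaves.length) :
    ∃ l, SubAt t o (.leaf l) (o + k) := by
  induction t generalizing o k with
  | leaf l =>
    simp only [LTree.leaves, List.length_singleton, Nat.lt_one_iff] at hk
    subst hk
    exact ⟨l, .refl _ _⟩
  | unary l t ih => obtain ⟨l', h⟩ := ih o hk; exact ⟨l', .unary h⟩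
  | binary l t₁ t₂ ih₁ ih₂ =>
    rw [LTree.leaves, List.length_append] at hk
    by_cases h : k < t₁.leaves.length
    · obtain ⟨l', h⟩ := ih₁ o h; exact ⟨l', .left h⟩
    · obtain ⟨l', h'⟩ := ih₂ (o + t₁.leaves.length) (k := k - t₁.leaves.length) (by omega)
      refine ⟨l', .right ?_⟩
      convert h' using 1; omega

theorem SubAt.getElem? {t s : LTree L} {a l : ℕ} (h : SubAt t 0 s a) (h1 : a ≤ l)
    (h2 : l < a + s.leaves.length) : t.leaves[l]? = s.leaves[l - a]? := by
  rw [h.leaves_eq, List.getElem?_take_of_lt (by omega), List.getElem?_drop]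
  congr 1; omega

end Trees

/-! ### Nonterminals occurring in parse trees. -/

section Labels

variable {G : RuleSet α}

theorem RuleSet.mem_labels_self (X : Fin G.m) : Label.nonterm X ∈ (G.parseTree X).labels := by
  induction X using G.induction with
  | atom X a h => rw [parseTree_atom h]; simp [LTree.labels]
  | concat X Y Z h => rw [parseTree_concat h]; simp [LTree.labels]
  | rep X Y r h => rw [parseTree_rep h]; simp [LTree.labels]
  | trunc X Y b e h => rw [parseTree_trunc h]; simp [LTree.labels]

theorem RuleSet.mem_labels_atom {W X : Fin G.m} {a : α} (h : G.rule X = .atom a) :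
    Label.nonterm W ∈ (G.parseTree X).labels ↔ W = X := by
  rw [parseTree_atom h]; simp [LTree.labels]

theorem RuleSet.mem_labels_concat {W X Y Z : Fin G.m} (h : G.rule X = .concat Y Z) :
    Label.nonterm W ∈ (G.parseTree X).labels ↔ W = X ∨
      Label.nonterm W ∈ (G.parseTree Y).labels ∨ Label.nonterm W ∈ (G.parseTree Z).labels := by
  rw [parseTree_concat h]; simp [LTree.labels, or_assoc]

theorem RuleSet.mem_labels_rep {W X Y : Fin G.m} {r : ℕ} (h : G.rule X = .rep Y r) :
    Label.nonterm W ∈ (G.parseTree X).labels ↔ W = X ∨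
      Label.nonterm W ∈ (G.parseTree Y).labels := by
  rw [parseTree_rep h]; simp [LTree.labels]

theorem RuleSet.mem_labels_trunc {W X Y : Fin G.m} {b e : ℕ} (h : G.rule X = .trunc Y b e) :
    Label.nonterm W ∈ (G.parseTree X).labels ↔ W = X := by
  rw [parseTree_trunc h]; simp [LTree.labels]

theorem RuleSet.mem_labels_trans {V W X : Fin G.m}
    (hV : Label.nonterm V ∈ (G.parseTree W).labels)
    (hW : Label.nonterm W ∈ (G.parseTree X).labels) :
    Label.nonterm V ∈ (G.parseTree X).labels := by
  induction X using G.induction with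
  | atom X a h => rw [mem_labels_atom h] at hW; exact hW ▸ hV
  | trunc X Y b e h => rw [mem_labels_trunc h] at hW; exact hW ▸ hV
  | concat X Y Z h _ _ ihY ihZ =>
    rcases (mem_labels_concat h).mp hW with rfl | hW | hW
    · exact hV
    · exact (mem_labels_concat h).mpr (.inr (.inl (ihY hW)))
    · exact (mem_labels_concat h).mpr (.inr (.inr (ihZ hW)))
  | rep X Y r h _ ihY =>
    rcases (mem_labels_rep h).mp hW with rfl | hW
    · exact hV
    · exact (mem_labels_rep h).mpr (.inr (ihY hW))

theorem RuleSet.Step.mem_labels {u v : List (α ⊕ Fin G.m)} (h : G.Step u v)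
    (hu : ∀ X, Sum.inr X ∈ u → Label.nonterm X ∈ (G.parseTree G.start).labels) :
    ∀ X, Sum.inr X ∈ v → Label.nonterm X ∈ (G.parseTree G.start).labels := by
  intro V hV
  cases h with
  | atom u v X a h =>
    refine hu V ?_
    simp only [List.mem_append, List.mem_singleton, reduceCtorEq, or_false] at hV ⊢
    tauto
  | concat u v X Y Z h =>
    have hX := hu X (by simp)
    simp only [List.mem_append, List.mem_cons, Sum.inr.injEq, List.not_mem_nil, or_false] at hV hu
    rcases hV with (hV | rfl | rfl) | hV
    · exact hu V (by tauto)
    · exact mem_labels_trans ((mem_labels_concat h).mpr (.inr (.inl (mem_labels_self _)))) hX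
    · exact mem_labels_trans ((mem_labels_concat h).mpr (.inr (.inr (mem_labels_self _)))) hX
    · exact hu V (by tauto)
  | rep u v X Y r h =>
    have hX := hu X (by simp)
    simp only [List.mem_append, List.mem_replicate, Sum.inr.injEq, List.mem_singleton] at hV hu
    rcases hV with (hV | ⟨-, rfl⟩) | hV
    · exact hu V (by tauto)
    · exact mem_labels_trans ((mem_labels_rep h).mpr (.inr (mem_labels_self _))) hX
    · exact hu V (by tauto)

/-- Expansion without truncations stays among the labels of the parse tree. Here internality enters:
it provides a node for the referent of each truncation. -/
theorem CollageSystem.Internal.mem_labels {G : CollageSystem α} (hG : G.Internal)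
    (X : Fin G.m) : Label.nonterm X ∈ (G.parseTree G.start).labels := by
  obtain ⟨w, hw, hX⟩ := hG X
  have : ∀ X, Sum.inr X ∈ w → Label.nonterm X ∈ (G.parseTree G.start).labels := by
    clear hX
    induction hw with
    | refl =>
      intro X hX
      simp only [List.mem_singleton, Sum.inr.injEq] at hX
      exact hX ▸ RuleSet.mem_labels_self _
    | tail _ hs ih => exact hs.mem_labels ih
  exact this X hX

/-! ### Pruned parse trees -/

variable {S : Set (Label α (Fin G.m))} {X : Fin G.m}

theorem RuleSet.prune_of_mem (hX : Label.nonterm X ∈ S) :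
    (G.parseTree X).prune S = .leaf (.nonterm X) := by
  induction X using G.induction with
  | atom X a h => rw [parseTree_atom h, LTree.prune, if_pos hX]
  | concat X Y Z h => rw [parseTree_concat h, LTree.prune, if_pos hX]
  | rep X Y r h => rw [parseTree_rep h, LTree.prune, if_pos hX]
  | trunc X Y b e h => rw [parseTree_trunc h, LTree.prune, if_pos hX]

theorem RuleSet.prune_atom {a : α} (h : G.rule X = .atom a) (hX : Label.nonterm X ∉ S) :
    (G.parseTree X).prune S = .unary (.nonterm X) (.leaf (.term a)) := by
  rw [parseTree_atom h, LTree.prune, if_neg hX, LTree.prune]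

theorem RuleSet.prune_concat {Y Z : Fin G.m} (h : G.rule X = .concat Y Z)
    (hX : Label.nonterm X ∉ S) : (G.parseTree X).prune S =
      .binary (.nonterm X) ((G.parseTree Y).prune S)
        ((G.parseTree Z).prune (S ∪ (G.parseTree Y).labels)) := by
  rw [parseTree_concat h, LTree.prune, if_neg hX]

theorem RuleSet.prune_rep {Y : Fin G.m} {r : ℕ} (h : G.rule X = .rep Y r)
    (hX : Label.nonterm X ∉ S) : (G.parseTree X).prune S =
      .binary (.nonterm X) ((G.parseTree Y).prune S) (.leaf (.pow Y (r - 1))) := by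
  rw [parseTree_rep h, LTree.prune, if_neg hX, LTree.prune]

theorem RuleSet.prune_trunc {Y : Fin G.m} {b e : ℕ} (h : G.rule X = .trunc Y b e)
    (hX : Label.nonterm X ∉ S) :
    (G.parseTree X).prune S = .unary (.nonterm X) (.leaf (.sub Y b e)) := by
  rw [parseTree_trunc h, LTree.prune, if_neg hX, LTree.prune]

/-- `S` contains, with every nonterminal, all the nonterminals below it. -/
def ClosedBelow (G : RuleSet α) (S : Set (Label α (Fin G.m))) : Prop :=
  ∀ X, Label.nonterm X ∈ S → ∀ W, Label.nonterm W ∈ (G.parseTree X).labels → Label.nonterm W ∈ S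

theorem ClosedBelow.union (hS : ClosedBelow G S) (Y : Fin G.m) :
    ClosedBelow G (S ∪ (G.parseTree Y).labels) := by
  rintro X (hX | hX) W hW
  · exact .inl (hS X hX W hW)
  · exact .inr (RuleSet.mem_labels_trans hW hX)

/-- Descend towards the leftmost occurrence of `W`, going right only if `W` is absent on the left.
No ancestor is pruned: an ancestor in `S` would put `W` in `S` by closure. -/
theorem exists_subAt_prune {W : Fin G.m} (o : ℕ) (hS : ClosedBelow G S)
    (hW : Label.nonterm W ∈ (G.parseTree X).labels) (hWS : Label.nonterm W ∉ S) :
    ∃ S' a, SubAt ((G.parseTree X).prune S) o ((G.parseTree W).prune S') a ∧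
      Label.nonterm W ∉ S' := by
  induction X using G.induction generalizing S o with
  | atom X a h =>
    rw [RuleSet.mem_labels_atom h] at hW
    subst hW
    exact ⟨S, o, .refl _ _, hWS⟩
  | trunc X Y b e h =>
    rw [RuleSet.mem_labels_trunc h] at hW
    subst hW
    exact ⟨S, o, .refl _ _, hWS⟩
  | concat X Y Z h _ _ ihY ihZ =>
    have hXS : Label.nonterm X ∉ S := fun hX => hWS (hS X hX W hW)
    rcases (RuleSet.mem_labels_concat h).mp hW with rfl | hW
    · exact ⟨S, o, .refl _ _, hWS⟩
    rw [RuleSet.prune_concat h hXS]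
    by_cases hY : Label.nonterm W ∈ (G.parseTree Y).labels
    · obtain ⟨S', a, h1, h2⟩ := ihY o hS hY hWS
      exact ⟨S', a, .left h1, h2⟩
    · obtain ⟨S', a, h1, h2⟩ := ihZ (o + ((G.parseTree Y).prune S).leaves.length) (hS.union Y)
        (hW.resolve_left hY) (fun h => h.elim hWS hY)
      exact ⟨S', a, .right h1, h2⟩
  | rep X Y r h _ ihY =>
    have hXS : Label.nonterm X ∉ S := fun hX => hWS (hS X hX W hW)
    rcases (RuleSet.mem_labels_rep h).mp hW with rfl | hW
    · exact ⟨S, o, .refl _ _, hWS⟩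
    rw [RuleSet.prune_rep h hXS]
    obtain ⟨S', a, h1, h2⟩ := ihY o hS hW hWS
    exact ⟨S', a, .left h1, h2⟩

/-- An unpruned nonterminal always has a child, so such a leaf has been pruned; its label was seen
before, and the earlier occurrence that survives lies wholly to the left. -/
theorem SubAt.leaf_nonterm {W : Fin G.m} {o k : ℕ} (hS : ClosedBelow G S)
    (h : SubAt ((G.parseTree X).prune S) o (.leaf (.nonterm W)) k) :
    Label.nonterm W ∈ S ∨ ∃ S' a, Label.nonterm W ∉ S' ∧
      SubAt ((G.parseTree X).prune S) o ((G.parseTree W).prune S') a ∧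
      a + ((G.parseTree W).prune S').leaves.length ≤ k := by
  induction X using G.induction generalizing S o with
  | atom X a hX =>
    by_cases hXS : Label.nonterm X ∈ S
    · rw [RuleSet.prune_of_mem hXS] at h
      cases h
      exact .inl hXS
    · rw [RuleSet.prune_atom hX hXS] at h
      cases h with
      | unary h => cases h
  | trunc X Y b e hX =>
    by_cases hXS : Label.nonterm X ∈ S
    · rw [RuleSet.prune_of_mem hXS] at h
      cases h
      exact .inl hXS
    · rw [RuleSet.prune_trunc hX hXS] at h
      cases h with
      | unary h => cases h
  | concat X Y Z hX _ _ ihY ihZ =>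
    by_cases hXS : Label.nonterm X ∈ S
    · rw [RuleSet.prune_of_mem hXS] at h
      cases h
      exact .inl hXS
    · rw [RuleSet.prune_concat hX hXS] at h ⊢
      cases h with
      | left h =>
        rcases ihY hS h with h | ⟨S', a, h1, h2, h3⟩
        · exact .inl h
        · exact .inr ⟨S', a, h1, .left h2, h3⟩
      | right h =>
        rcases ihZ (hS.union Y) h with h' | ⟨S', a, h1, h2, h3⟩
        · by_cases hWS : Label.nonterm W ∈ S
          · exact .inl hWS
          · obtain ⟨S', a, h1, h2⟩ := exists_subAt_prune o hS (h'.resolve_left hWS) hWS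
            have := h1.bounds
            have := h.bounds
            exact .inr ⟨S', a, h2, .left h1, by omega⟩
        · exact .inr ⟨S', a, h1, .right h2, h3⟩
  | rep X Y r hX _ ihY =>
    by_cases hXS : Label.nonterm X ∈ S
    · rw [RuleSet.prune_of_mem hXS] at h
      cases h
      exact .inl hXS
    · rw [RuleSet.prune_rep hX hXS] at h ⊢
      cases h with
      | left h =>
        rcases ihY hS h with h | ⟨S', a, h1, h2, h3⟩
        · exact .inl h
        · exact .inr ⟨S', a, h1, .left h2, h3⟩
      | right h => cases h

/-- The node for `Y` is the left sibling, and `s` is the parent; their leaf intervals are the two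
intervals that a type B factor induces. -/
theorem SubAt.leaf_pow {Y : Fin G.m} {n o k : ℕ}
    (h : SubAt ((G.parseTree X).prune S) o (.leaf (.pow Y n)) k) :
    ∃ V r S' a s, G.rule V = .rep Y r ∧ n = r - 1 ∧
      SubAt ((G.parseTree X).prune S) o ((G.parseTree Y).prune S') a ∧
      a + ((G.parseTree Y).prune S').leaves.length = k ∧
      SubAt ((G.parseTree X).prune S) o s a ∧ a + s.leaves.length = k + 1 := by
  induction X using G.induction generalizing S o with
  | atom X a hX =>
    by_cases hXS : Label.nonterm X ∈ S
    · rw [RuleSet.prune_of_mem hXS] at h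
      cases h
    · rw [RuleSet.prune_atom hX hXS] at h
      cases h with
      | unary h => cases h
  | trunc X Y b e hX =>
    by_cases hXS : Label.nonterm X ∈ S
    · rw [RuleSet.prune_of_mem hXS] at h
      cases h
    · rw [RuleSet.prune_trunc hX hXS] at h
      cases h with
      | unary h => cases h
  | concat X Y' Z hX _ _ ihY ihZ =>
    by_cases hXS : Label.nonterm X ∈ S
    · rw [RuleSet.prune_of_mem hXS] at h
      cases h
    · rw [RuleSet.prune_concat hX hXS] at h ⊢
      cases h with
      | left h =>
        obtain ⟨V, r, S', a, s, h1, h2, h3, h4, h5, h6⟩ := ihY h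
        exact ⟨V, r, S', a, s, h1, h2, .left h3, h4, .left h5, h6⟩
      | right h =>
        obtain ⟨V, r, S', a, s, h1, h2, h3, h4, h5, h6⟩ := ihZ h
        exact ⟨V, r, S', a, s, h1, h2, .right h3, h4, .right h5, h6⟩
  | rep X Y' r hX _ ihY =>
    by_cases hXS : Label.nonterm X ∈ S
    · rw [RuleSet.prune_of_mem hXS] at h
      cases h
    · rw [RuleSet.prune_rep hX hXS] at h ⊢
      cases h with
      | left h =>
        obtain ⟨V, r, S', a, s, h1, h2, h3, h4, h5, h6⟩ := ihY h
        exact ⟨V, r, S', a, s, h1, h2, .left h3, h4, .left h5, h6⟩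
      | right h =>
        cases h
        refine ⟨X, r, S, o, _, hX, rfl, .left (.refl _ _), rfl, .refl _ _, ?_⟩
        simp only [LTree.leaves, List.length_append, List.length_singleton]
        omega

theorem SubAt.leaf_sub {Y : Fin G.m} {b e o k : ℕ}
    (h : SubAt ((G.parseTree X).prune S) o (.leaf (.sub Y b e)) k) :
    ∃ V, G.rule V = .trunc Y b e := by
  induction X using G.induction generalizing S o with
  | atom X a hX =>
    by_cases hXS : Label.nonterm X ∈ S
    · rw [RuleSet.prune_of_mem hXS] at h
      cases h
    · rw [RuleSet.prune_atom hX hXS] at h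
      cases h with
      | unary h => cases h
  | trunc X Y b e hX =>
    by_cases hXS : Label.nonterm X ∈ S
    · rw [RuleSet.prune_of_mem hXS] at h
      cases h
    · rw [RuleSet.prune_trunc hX hXS] at h
      cases h with
      | unary h => cases h; exact ⟨X, hX⟩
  | concat X Y' Z hX _ _ ihY ihZ =>
    by_cases hXS : Label.nonterm X ∈ S
    · rw [RuleSet.prune_of_mem hXS] at h
      cases h
    · rw [RuleSet.prune_concat hX hXS] at h
      cases h with
      | left h => exact ihY h
      | right h => exact ihZ h
  | rep X Y' r hX _ ihY =>
    by_cases hXS : Label.nonterm X ∈ S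
    · rw [RuleSet.prune_of_mem hXS] at h
      cases h
    · rw [RuleSet.prune_rep hX hXS] at h
      cases h with
      | left h => exact ihY h
      | right h => cases h

/-- A reference depth for the leaves of grammar trees. -/
def Label.depth {m : ℕ} : Label α (Fin m) → ℕ
  | .term _ => 0
  | .nonterm X => 2 * X + 1
  | .pow Y _ => 2 * Y + 2
  | .sub Y _ _ => 2 * Y + 2

/-- For `Y < X` the values `2 * Y + 1 < 2 * Y + 2 < 2 * X + 1` leave room for powers and truncations
of `Y` strictly between `Y` and `X`. The bound for `X` is attained only if `X` is itself pruned to a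
leaf. -/
theorem RuleSet.depth_leaves_prune (X : Fin G.m) (S : Set (Label α (Fin G.m))) :
    ∀ l ∈ ((G.parseTree X).prune S).leaves,
      l.depth ≤ 2 * X + 1 ∧ (Label.nonterm X ∉ S → l.depth < 2 * X + 1) := by
  by_cases hXS : Label.nonterm X ∈ S
  · rw [prune_of_mem hXS]
    simp [LTree.leaves, Label.depth, hXS]
  suffices h : ∀ l ∈ ((G.parseTree X).prune S).leaves, l.depth < 2 * X + 1 from
    fun l hl => ⟨(h l hl).le, fun _ => h l hl⟩
  induction X using G.induction generalizing S with
  | atom X a hX =>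
    rw [prune_atom hX hXS]
    simp [LTree.leaves, Label.depth]
  | trunc X Y b e hX hY =>
    rw [prune_trunc hX hXS]
    rw [Fin.lt_def] at hY
    simp [LTree.leaves, Label.depth]
    omega
  | concat X Y Z hX hY hZ ihY ihZ =>
    rw [Fin.lt_def] at hY hZ
    rw [prune_concat hX hXS]
    intro l hl
    rcases List.mem_append.mp hl with hl | hl
    · by_cases hYS : Label.nonterm Y ∈ S
      · rw [prune_of_mem hYS] at hl
        simp only [LTree.leaves, List.mem_singleton] at hl
        subst hl
        simp only [Label.depth]; omega
      · have := ihY S hYS l hl; omega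
    · by_cases hZS : Label.nonterm Z ∈ S ∪ (G.parseTree Y).labels
      · rw [prune_of_mem hZS] at hl
        simp only [LTree.leaves, List.mem_singleton] at hl
        subst hl
        simp only [Label.depth]; omega
      · have := ihZ _ hZS l hl; omega
  | rep X Y r hX hY ihY =>
    rw [Fin.lt_def] at hY
    rw [prune_rep hX hXS]
    intro l hl
    rcases List.mem_append.mp hl with hl | hl
    · by_cases hYS : Label.nonterm Y ∈ S
      · rw [prune_of_mem hYS] at hl
        simp only [LTree.leaves, List.mem_singleton] at hl
        subst hl
        simp only [Label.depth]; omega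
      · have := ihY S hYS l hl; omega
    · simp only [LTree.leaves, List.mem_singleton] at hl
      subst hl
      simp only [Label.depth]; omega

end Labels

/-- A pruned node keeps its label, which still derives the string of the deleted subtree. -/
theorem CollageSystem.leaves_prune_flatten (G : CollageSystem α) (X : Fin G.m)
    (S : Set (Label α (Fin G.m))) :
    (((G.parseTree X).prune S).leaves.map G.labelString).flatten = G.expand X := by
  by_cases hXS : Label.nonterm X ∈ S
  · rw [RuleSet.prune_of_mem hXS]
    simp [LTree.leaves, RuleSet.labelString]
  induction X using G.toRuleSet.induction generalizing S with
  | atom X a hX =>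
    rw [RuleSet.prune_atom hX hXS, RuleSet.expand_atom hX]
    simp [LTree.leaves, RuleSet.labelString]
  | trunc X Y b e hX hY =>
    rw [RuleSet.prune_trunc hX hXS, RuleSet.expand_trunc hX]
    simp [LTree.leaves, RuleSet.labelString]
  | concat X Y Z hX hY hZ ihY ihZ =>
    have key : ∀ (Y : Fin G.m) (S : Set (Label α (Fin G.m))), (Label.nonterm Y ∉ S →
        (((G.parseTree Y).prune S).leaves.map G.labelString).flatten = G.expand Y) →
        (((G.parseTree Y).prune S).leaves.map G.labelString).flatten = G.expand Y := by
      intro Y S h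
      by_cases hYS : Label.nonterm Y ∈ S
      · rw [RuleSet.prune_of_mem hYS]
        simp [LTree.leaves, RuleSet.labelString]
      · exact h hYS
    rw [RuleSet.prune_concat hX hXS, RuleSet.expand_concat hX, LTree.leaves, List.map_append,
      List.flatten_append, key Y S (ihY S), key Z _ (ihZ _)]
  | rep X Y r hX hY ihY =>
    have key : (((G.parseTree Y).prune S).leaves.map G.labelString).flatten = G.expand Y := by
      by_cases hYS : Label.nonterm Y ∈ S
      · rw [RuleSet.prune_of_mem hYS]
        simp [LTree.leaves, RuleSet.labelString]
      · exact ihY S hYS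
    rw [RuleSet.prune_rep hX hXS, RuleSet.expand_rep hX, LTree.leaves, List.map_append,
      List.flatten_append, key, power_pred _ (G.two_lt_of_rep X Y r hX)]
    simp [LTree.leaves, RuleSet.labelString]

/-! ### From a grammar tree to a reference structure. -/

section Forward

variable {G : CollageSystem α}

theorem seg_map_leaves {t : LTree (Label α (Fin G.m))} {a : ℕ} {X : Fin G.m}
    {S : Set (Label α (Fin G.m))} (h : SubAt t 0 ((G.parseTree X).prune S) a) :
    seg (t.leaves.map G.labelString) a (a + ((G.parseTree X).prune S).leaves.length) =
      G.expand X := by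
  rw [← G.leaves_prune_flatten X S, seg, Nat.add_sub_cancel_left]
  conv_rhs => rw [h.leaves_eq]
  rw [List.map_take, List.map_drop, Nat.sub_zero]

open Classical in
/-- The reference depth of the leaf with index `k` of a tree. -/
noncomputable def leafDepth (G : CollageSystem α) (t : LTree (Label α (Fin G.m))) (k : ℕ) : ℕ :=
  -- A leaf labelled by a nonterminal may derive a single symbol; its depth must then be `0`.
  if Long (t.leaves.map G.labelString) k then (t.leaves[k]?).elim 0 Label.depth else 0

theorem leafDepth_lt {t : LTree (Label α (Fin G.m))} {a n : ℕ} {X : Fin G.m}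
    {S : Set (Label α (Fin G.m))} (h : SubAt t 0 ((G.parseTree X).prune S) a) (hn : 0 < n)
    (hd : ∀ l ∈ ((G.parseTree X).prune S).leaves, l.depth < n) {k : ℕ} (h1 : a ≤ k)
    (h2 : k < a + ((G.parseTree X).prune S).leaves.length) :
    (t.leaves[k]?).elim 0 Label.depth < n ∧ leafDepth G t k < n := by
  have key : (t.leaves[k]?).elim 0 Label.depth < n := by
    rw [h.getElem? h1 h2, List.getElem?_eq_getElem (by omega)]
    exact hd _ (List.getElem_mem _)
  refine ⟨key, ?_⟩
  rw [leafDepth]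
  split
  · exact key
  · exact hn

theorem closedBelow_empty (G : RuleSet α) : ClosedBelow G ∅ := fun _ h => h.elim

/-- The kind of the leaf label decides the type: nonterminal, power and truncation give A, B and C.
The subtree clauses are kept for laminarity. -/
theorem CollageSystem.Internal.exists_ref (hG : G.Internal) {k : ℕ}
    (hk : Long G.leafStrings k) :
    ∃ (ty : FactorType) (i j : ℕ), i < j ∧ j ≤ G.leafStrings.length ∧
      (ty = .A → j ≤ k ∧ G.leafStrings.getD k [] = seg G.leafStrings i j) ∧
      (ty = .B → j = k ∧
        ∃ r, 3 ≤ r ∧ G.leafStrings.getD k [] = power (seg G.leafStrings i j) (r - 1)) ∧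
      (ty = .C → (k < i ∨ j ≤ k) ∧ G.leafStrings.getD k [] <:+: seg G.leafStrings i j) ∧
      (∃ s, SubAt G.grammarTree 0 s i ∧ j = i + s.leaves.length) ∧
      (ty = .B → ∃ s, SubAt G.grammarTree 0 s i ∧ k + 1 = i + s.leaves.length) ∧
      ∀ l, i ≤ l → l < j → leafDepth G G.grammarTree l < leafDepth G G.grammarTree k := by
  have hkl := hk.lt_length
  rw [RuleSet.leafStrings, List.length_map] at hkl
  obtain ⟨ℓ, hℓ⟩ := G.grammarTree.exists_subAt_leaf 0 hkl
  rw [Nat.zero_add] at hℓ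
  have hget : G.grammarTree.leaves[k]? = some ℓ := by
    rw [hℓ.getElem? le_rfl (by simp [LTree.leaves])]
    simp [LTree.leaves]
  have hstr : G.leafStrings.getD k [] = G.labelString ℓ := by
    simp [RuleSet.leafStrings, hget]
  have hdep : leafDepth G G.grammarTree k = ℓ.depth := by
    refine (if_pos hk).trans ?_
    rw [hget]
    rfl
  have hlong : 1 < (G.labelString ℓ).length := hstr ▸ hk
  have hle : ∀ {s a}, SubAt G.grammarTree 0 s a →
      a + s.leaves.length ≤ G.leafStrings.length := by
    intro s a h
    rw [RuleSet.leafStrings, List.length_map]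
    simpa using h.bounds.2
  have hpos := fun {s : LTree (Label α (Fin G.m))} => s.length_leaves_pos
  rw [hstr, hdep]
  rcases ℓ with c | X | ⟨Y, n⟩ | ⟨Y, b, e⟩
  · simp [RuleSet.labelString] at hlong
  · obtain h | ⟨S, a, h1, h2, h3⟩ := hℓ.leaf_nonterm (closedBelow_empty _)
    · exact h.elim
    refine ⟨.A, a, _, Nat.lt_add_of_pos_right hpos, hle h2,
      fun _ => ⟨h3, (seg_map_leaves h2).symm⟩, by simp, by simp, ⟨_, h2, rfl⟩, by simp, ?_⟩
    intro l hl1 hl2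
    exact (leafDepth_lt h2 (by simp)
      (fun ℓ hℓ => (RuleSet.depth_leaves_prune X S ℓ hℓ).2 h1) hl1 hl2).2
  · obtain ⟨V, r, S, a, s, h1, h2, h3, h4, h5, h6⟩ := hℓ.leaf_pow
    refine ⟨.B, a, _, Nat.lt_add_of_pos_right hpos, hle h3, by simp,
      fun _ => ⟨h4, r, G.two_lt_of_rep _ _ _ h1, ?_⟩, by simp, ⟨_, h3, rfl⟩,
      fun _ => ⟨s, h5, h6.symm⟩, ?_⟩
    · rw [h2]
      exact congrArg (power · (r - 1)) (seg_map_leaves h3).symm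
    · intro l hl1 hl2
      exact (leafDepth_lt h3 (by simp) (fun ℓ hℓ => Nat.lt_succ_of_le
        (RuleSet.depth_leaves_prune Y S ℓ hℓ).1) hl1 hl2).2
  · obtain ⟨V, hV⟩ := hℓ.leaf_sub
    obtain ⟨S, a, h1, h2⟩ :=
      exists_subAt_prune 0 (closedBelow_empty _) (hG.mem_labels Y) (Set.notMem_empty _)
    have hd : ∀ l, a ≤ l → l < a + ((G.parseTree Y).prune S).leaves.length →
        (G.grammarTree.leaves[l]?).elim 0 Label.depth < 2 * Y + 2 ∧
          leafDepth G G.grammarTree l < 2 * Y + 2 :=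
      fun l hl1 hl2 => leafDepth_lt h1 (by simp) (fun ℓ hℓ => Nat.lt_succ_of_le
        (RuleSet.depth_leaves_prune Y S ℓ hℓ).1) hl1 hl2
    refine ⟨.C, a, _, Nat.lt_add_of_pos_right hpos, hle h1, by simp, by simp,
      fun _ => ⟨?_, ?_⟩, ⟨_, h1, rfl⟩, by simp, fun l hl1 hl2 => (hd l hl1 hl2).2⟩
    -- All leaves below `Y` have label depth less than `2 * Y + 2`, the depth of the leaf `k`
    -- itself, so `k` is not among them.
    · by_contra hcon
      have := (hd k (by omega) (by omega)).1
      rw [hget] at this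
      exact lt_irrefl _ this
    · have := seg_map_leaves h1
      rw [RuleSet.leafStrings, RuleSet.grammarTree, this]
      exact (List.take_prefix _ _).isInfix.trans (List.drop_suffix _ _).isInfix

theorem CollageSystem.Internal.exists_refs (hG : G.Internal) :
    ∃ ty i j D, Refs G.leafStrings ty i j D := by
  classical
  have h : ∀ k, ∃ (ty : FactorType) (i j : ℕ), Long G.leafStrings k → _ := fun k => by
    by_cases hk : Long G.leafStrings k
    · obtain ⟨ty, i, j, h⟩ := hG.exists_ref hk
      exact ⟨ty, i, j, fun _ => h⟩
    · exact ⟨.A, 0, 0, fun h => absurd h hk⟩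
  choose ty i j h using h
  have key : ∀ a b, IsRef G.leafStrings ty i j a b →
      ∃ s, SubAt G.grammarTree 0 s a ∧ b = a + s.leaves.length := by
    rintro a b ⟨k, hk, rfl, rfl | ⟨hty, rfl⟩⟩
    · exact (h k hk).2.2.2.2.2.1
    · exact (h k hk).2.2.2.2.2.2.1 hty
  refine ⟨ty, i, j, leafDepth G G.grammarTree, fun k hk => ⟨(h k hk).1, (h k hk).2.1⟩,
    fun k hk => (h k hk).2.2.1, fun k hk => (h k hk).2.2.2.1, fun k hk => (h k hk).2.2.2.2.1, ?_,
    ?_, fun k hk => (h k hk).2.2.2.2.2.2.2⟩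
  · intro a b c d h1 h2
    obtain ⟨s, hs, rfl⟩ := key a b h1
    obtain ⟨s', hs', rfl⟩ := key c d h2
    exact hs.compat hs'
  · intro k hk
    exact if_neg hk

end Forward

/-! ### Removing references to single repetition factors. -/

section Normalize

variable {F : List (List α)} {ty : ℕ → FactorType} {i j D : ℕ → ℕ}

/-- A leaf `Y^(r-1)` carries no nonterminal and cannot be referred to. A factor referring to just
such a leaf becomes a truncation of the whole repetition `Y^r`, of which it is a substring. -/
theorem Refs.exists_normalized (hR : Refs F ty i j D) :
    ∃ ty i, Refs F ty i j D ∧ ∀ k, Long F k → j k = i k + 1 → Long F (i k) → ty (i k) ≠ .B := by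
  classical
  let bad : ℕ → Prop := fun k => Long F k ∧ j k = i k + 1 ∧ Long F (i k) ∧ ty (i k) = .B
  -- If `k` were of type B, then `i k = k - 1`, and the repetition intervals `[k - 1, k + 1)` and
  -- `[i (k - 1), k)` would cross.
  have hbad : ∀ k, bad k → ty k ≠ .B := by
    rintro k ⟨h1, h2, h3, h4⟩ h5
    have h6 := hR.rep k h1 h5
    have h7 := hR.rep _ h3 h4
    have h8 := hR.lt _ h3
    have := hR.compat _ _ _ _ ⟨k, h1, rfl, .inr ⟨h5, rfl⟩⟩ ⟨i k, h3, rfl, .inr ⟨h4, rfl⟩⟩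
    unfold Compat at this
    omega
  let ty' : ℕ → FactorType := fun k => if bad k then .C else ty k
  let i' : ℕ → ℕ := fun k => if bad k then i (i k) else i k
  have tp : ∀ k, bad k → ty' k = .C := fun k h => if_pos h
  have tn : ∀ k, ¬ bad k → ty' k = ty k := fun k h => if_neg h
  have ip : ∀ k, bad k → i' k = i (i k) := fun k h => if_pos h
  have iN : ∀ k, ¬ bad k → i' k = i k := fun k h => if_neg h
  have hB : ∀ k, ty' k = .B ↔ ty k = .B := by
    intro k
    by_cases hk : bad k
    · simp [tp k hk, hbad k hk]
    · rw [tn k hk]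
  refine ⟨ty', i', ⟨?_, ?_, ?_, ?_, ?_, hR.depth_zero, ?_⟩, ?_⟩
  · intro k hk
    have h := hR.lt k hk
    by_cases hb : bad k
    · have h7 := hR.rep _ hb.2.2.1 hb.2.2.2
      have h8 := hR.lt _ hb.2.2.1
      rw [ip k hb]; omega
    · rwa [iN k hb]
  · intro k hk ht
    by_cases hb : bad k
    · rw [tp k hb] at ht; cases ht
    · rw [tn k hb] at ht; rw [iN k hb]; exact hR.copy k hk ht
  · intro k hk ht
    by_cases hb : bad k
    · rw [tp k hb] at ht; cases ht
    · rw [tn k hb] at ht; rw [iN k hb]; exact hR.rep k hk ht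
  · intro k hk ht
    by_cases hb : bad k
    · rw [ip k hb]
      obtain ⟨-, h2, h3, h4⟩ := id hb
      have h5 := hR.rep _ h3 h4
      have h6 := hR.lt _ h3
      have h7 := hR.depth_lt k hk (i k) le_rfl (by omega)
      have h8 : (k < i k ∨ j k ≤ k) ∧ F.getD k [] <:+: seg F (i k) (j k) := by
        rcases hty : ty k
        · obtain ⟨h, h'⟩ := hR.copy k hk hty
          exact ⟨.inr h, h' ▸ List.infix_refl _⟩
        · exact absurd hty (hbad k hb)
        · exact hR.trunc k hk hty
      refine ⟨?_, h8.2.trans ?_⟩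
      -- If `k` were inside the enlarged reference, it would lie in the reference of `i k`, giving
      -- `D k < D (i k) < D k`.
      · by_contra hcon
        have := hR.depth_lt _ h3 k (by omega) (by omega)
        omega
      · rw [← seg_append F (show i (i k) ≤ i k by omega) (show i k ≤ j k by omega)]
        exact (List.suffix_append _ _).isInfix
    · rw [tn k hb] at ht; rw [iN k hb]; exact hR.trunc k hk ht
  -- The enlarged reference is the repetition interval of the factor `i k`, so no new interval
  -- arises.
  · have key : ∀ a b, IsRef F ty' i' j a b → IsRef F ty i j a b := by
      rintro a b ⟨k, hk, rfl, h⟩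
      rw [hB] at h
      by_cases hb : bad k
      · rw [ip k hb]
        obtain ⟨-, h2, h3, h4⟩ := id hb
        rcases h with rfl | ⟨h, -⟩
        · exact ⟨i k, h3, rfl, .inr ⟨h4, h2⟩⟩
        · exact absurd h (hbad k hb)
      · exact ⟨k, hk, iN k hb, h⟩
    exact fun a b c d h1 h2 => hR.compat a b c d (key a b h1) (key c d h2)
  · intro k hk l
    by_cases hb : bad k
    · rw [ip k hb]
      obtain ⟨-, h2, h3, h4⟩ := id hb
      have h5 := hR.rep _ h3 h4
      have h7 := hR.depth_lt k hk (i k) le_rfl (by omega)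
      intro h8 h9
      rcases (show l ≤ i k by omega).eq_or_lt with rfl | h
      · exact h7
      · exact (hR.depth_lt _ h3 l h8 (by omega)).trans h7
    · rw [iN k hb]; exact hR.depth_lt k hk l
  · intro k hk hj hl
    rw [Ne, hB]
    by_cases hb : bad k
    · have h5 := hR.rep _ hb.2.2.1 hb.2.2.2
      have h6 := hR.lt _ hb.2.2.1
      rw [ip k hb] at hj
      have := hb.2.1
      omega
    · rw [iN k hb] at hj hl ⊢
      exact fun h => hb ⟨hk, hj, hl, h⟩

end Normalize

/-! ### Binary trees of intervals -/

section Nodes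

variable {R : ℕ → ℕ → Prop}

open Classical in
/-- The position at which the interval `[a, b)` is split: the largest `c < b` such that `[a, c)` is
in the family `R`, or else `a + 1`. -/
noncomputable def split (R : ℕ → ℕ → Prop) (a b : ℕ) : ℕ :=
  Nat.findGreatest (fun c => a < c ∧ (c = a + 1 ∨ R a c)) (b - 1)

theorem split_spec {a b : ℕ} (h : a + 1 < b) :
    a < split R a b ∧ split R a b < b ∧ (split R a b = a + 1 ∨ R a (split R a b)) := by
  classical
  have h1 := Nat.findGreatest_spec (P := fun c => a < c ∧ (c = a + 1 ∨ R a c))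
    (show a + 1 ≤ b - 1 by omega) ⟨Nat.lt_succ_self a, .inl rfl⟩
  have h2 := Nat.findGreatest_le (P := fun c => a < c ∧ (c = a + 1 ∨ R a c)) (b - 1)
  refine ⟨?_, ?_, ?_⟩ <;> unfold split
  · convert h1.1
  · refine lt_of_le_of_lt (b := b - 1) ?_ (by omega)
    convert h2
  · convert h1.2

theorem le_split {a b c : ℕ} (hac : a < c) (hcb : c < b) (h : R a c) : c ≤ split R a b := by
  classical
  unfold split
  convert Nat.le_findGreatest (P := fun c => a < c ∧ (c = a + 1 ∨ R a c))
    (show c ≤ b - 1 by omega) ⟨hac, .inr h⟩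

/-- `[x, y)` is a node of the binary tree obtained by splitting `[a, b)` repeatedly. -/
inductive Node (R : ℕ → ℕ → Prop) : ℕ → ℕ → ℕ → ℕ → Prop
  | refl (a b) : Node R a b a b
  | left {a b x y} : a + 1 < b → Node R a (split R a b) x y → Node R a b x y
  | right {a b x y} : a + 1 < b → Node R (split R a b) b x y → Node R a b x y

theorem Node.bounds {a b x y : ℕ} (h : Node R a b x y) (hab : a < b) : a ≤ x ∧ x < y ∧ y ≤ b := by
  induction h with
  | refl => exact ⟨le_rfl, hab, le_rfl⟩
  | left h _ ih => have := split_spec (R := R) h; have := ih this.1; omega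
  | right h _ ih => have := split_spec (R := R) h; have := ih this.2.1; omega

theorem Node.trans {a b c d x y : ℕ} (h : Node R a b c d) (h' : Node R c d x y) :
    Node R a b x y := by
  induction h with
  | refl => exact h'
  | left h _ ih => exact .left h (ih h')
  | right h _ ih => exact .right h (ih h')

/-- Relative to `[p, q)`, another node contains it, is disjoint from it, or lies below one of its
two children. -/
theorem Node.cases {a b p q x y : ℕ} (hab : a < b) (h : Node R a b p q) (h' : Node R a b x y) :
    (x ≤ p ∧ q ≤ y) ∨ q ≤ x ∨ y ≤ p ∨
      (p + 1 < q ∧ (Node R p (split R p q) x y ∨ Node R (split R p q) q x y)) := by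
  induction h with
  | refl =>
    cases h' with
    | refl => exact .inl ⟨le_rfl, le_rfl⟩
    | left h h' => exact .inr (.inr (.inr ⟨h, .inl h'⟩))
    | right h h' => exact .inr (.inr (.inr ⟨h, .inr h'⟩))
  | left h hn ih =>
    have hs := split_spec (R := R) h
    have := hn.bounds hs.1
    cases h' with
    | refl => exact .inl (by omega)
    | left _ h' => exact ih hs.1 h'
    | right _ h' => have := h'.bounds hs.2.1; exact .inr (.inl (by omega))
  | right h hn ih =>
    have hs := split_spec (R := R) h
    have := hn.bounds hs.2.1
    cases h' with
    | refl => exact .inl (by omega)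
    | left _ h' => have := h'.bounds hs.1; exact .inr (.inr (.inl (by omega)))
    | right _ h' => exact ih hs.2.1 h'

/-- A split strictly inside `[x, y)` would force `x = a`: otherwise the left part is a member of `R`
crossing `[x, y)`. But then the maximality of the split puts it at `y` or later. -/
theorem Node.of_compat {a b x y : ℕ} (hax : a ≤ x) (hxy : x < y) (hyb : y ≤ b)
    (hall : ∀ c d, R c d → Compat c d x y) (hxR : R x y) : Node R a b x y := by
  induction hn : b - a using Nat.strong_induction_on generalizing a b with
  | _ n ih =>
    subst hn
    by_cases he : x = a ∧ y = b
    · rw [he.1, he.2]; exact .refl _ _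
    have hab : a + 1 < b := by omega
    have hs := split_spec (R := R) hab
    by_cases h1 : split R a b ≤ x
    · exact .right hab (ih _ (by omega) h1 hyb rfl)
    by_cases h2 : y ≤ split R a b
    · exact .left hab (ih _ (by omega) hax h2 rfl)
    have hxa : x = a := by
      rcases hs.2.2 with h | h
      · omega
      · have := hall _ _ h
        unfold Compat at this
        omega
    subst hxa
    have := le_split hxy (show y < b by omega) hxR
    omega

theorem Node.single {a b k : ℕ} (hak : a ≤ k) (hkb : k < b) : Node R a b k (k + 1) := by
  induction hn : b - a using Nat.strong_induction_on generalizing a b with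
  | _ n ih =>
    subst hn
    by_cases he : b = a + 1
    · obtain rfl : k = a := by omega
      rw [he]; exact .refl _ _
    have hab : a + 1 < b := by omega
    have hs := split_spec (R := R) hab
    by_cases h1 : split R a b ≤ k
    · exact .right hab (ih _ (by omega) h1 hkb rfl)
    · exact .left hab (ih _ (by omega) hak (by omega) rfl)

end Nodes

/-! ### Nonterminals and rules attached to the nodes. -/

section Labelling

variable (F : List (List α)) (ty : ℕ → FactorType) (i j : ℕ → ℕ)

open Classical in
/-- The interval that determines the nonterminal of the factor with index `k`: references of copies
are followed, and short factors are sent to their first occurrence. -/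
noncomputable def singleLab (k : ℕ) : ℕ × ℕ :=
  if Long F k then
    if ty k = .A then
      if i k + 1 = j k then
        -- The test serves termination only: in a reference structure a copy refers to the left.
        if i k < k then singleLab (i k) else (k, k + 1)
      else (i k, j k)
    else (k, k + 1)
  else (Nat.find (p := fun l => F.getD l [] = F.getD k []) ⟨k, rfl⟩,
    Nat.find (p := fun l => F.getD l [] = F.getD k []) ⟨k, rfl⟩ + 1)
termination_by k

/-- The interval that determines the nonterminal of the interval `[a, b)`. -/
noncomputable def lab (a b : ℕ) : ℕ × ℕ := if b = a + 1 then singleLab F ty i j a else (a, b)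

/-- `[a, b)` is a node of the tree of the reference structure, other than the leaf of a
repetition factor. -/
def IsGood (a b : ℕ) : Prop :=
  Node (IsRef F ty i j) 0 F.length a b ∧ ¬ (b = a + 1 ∧ Long F a ∧ ty a = .B)

/-- The node `[a, b)` is the leftmost one with its nonterminal. -/
def IsMain (a b : ℕ) : Prop := IsGood F ty i j a b ∧ lab F ty i j a b = (a, b)

/-- References of nonterminals to each other decrease this rank. -/
def rank (D : ℕ → ℕ) (a b : ℕ) : ℕ := (Finset.Ico a b).sup D * (F.length + 1) + (b - a)

/-- The references are normalized: none of them is a single repetition factor. -/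
def Normalized : Prop := ∀ k, Long F k → j k = i k + 1 → Long F (i k) → ty (i k) ≠ .B

variable {F ty i j} {D : ℕ → ℕ}

theorem IsGood.bounds {a b : ℕ} (hF : F ≠ []) (h : IsGood F ty i j a b) :
    a < b ∧ b ≤ F.length :=
  (h.1.bounds (List.length_pos_iff.mpr hF)).2

theorem Refs.node_of_isRef (hR : Refs F ty i j D) {x y : ℕ} (h : IsRef F ty i j x y) :
    Node (IsRef F ty i j) 0 F.length x y := by
  have hxy : x < y ∧ y ≤ F.length := by
    obtain ⟨k, hk, rfl, rfl | ⟨hty, rfl⟩⟩ := id h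
    · exact hR.lt k hk
    · have := hR.lt k hk
      have := hR.rep k hk hty
      have := hk.lt_length
      omega
  exact .of_compat (Nat.zero_le x) hxy.1 hxy.2 (fun c d hcd => hR.compat _ _ _ _ hcd h) h

theorem Refs.isGood_ref (hR : Refs F ty i j D) (hN : Normalized F ty i j) {k : ℕ}
    (hk : Long F k) : IsGood F ty i j (i k) (j k) :=
  ⟨hR.node_of_isRef ⟨k, hk, rfl, .inl rfl⟩, fun h => hN k hk h.1 h.2.1 h.2.2⟩

theorem Refs.isGood_root (hR : Refs F ty i j D) : IsGood F ty i j 0 F.length := by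
  refine ⟨.refl _ _, ?_⟩
  rintro ⟨-, hl, hty⟩
  have := hR.lt 0 hl
  have := hR.rep 0 hl hty
  omega

theorem Refs.sup_lt (hR : Refs F ty i j D) {k : ℕ} (hk : Long F k) :
    (Finset.Ico (i k) (j k)).sup D < D k := by
  have h0 : 0 < D k :=
    lt_of_le_of_lt (Nat.zero_le _) (hR.depth_lt k hk (i k) le_rfl (hR.lt k hk).1)
  refine (Finset.sup_lt_iff h0).mpr fun l hl => ?_
  rw [Finset.mem_Ico] at hl
  exact hR.depth_lt k hk l hl.1 hl.2

/-- The reference has smaller maximal depth, and one unit of depth outweighs any length, which is at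
most `F.length`. -/
theorem Refs.rank_ref_lt (hR : Refs F ty i j D) {k : ℕ} (hk : Long F k) :
    rank F D (i k) (j k) < rank F D k (k + 1) := by
  have h1 := hR.sup_lt hk
  have h2 := hR.lt k hk
  simp only [rank, Nat.Ico_succ_singleton, Finset.sup_singleton]
  have := Nat.mul_le_mul_right (F.length + 1) (Nat.succ_le_of_lt h1)
  rw [Nat.succ_mul] at this
  omega

theorem rank_lt_of_subset {a b c d : ℕ} (h1 : a ≤ c) (h2 : d ≤ b) (h3 : d - c < b - a) :
    rank F D c d < rank F D a b := by
  have : (Finset.Ico c d).sup D ≤ (Finset.Ico a b).sup D :=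
    Finset.sup_mono (Finset.Ico_subset_Ico h1 h2)
  have := Nat.mul_le_mul_right (F.length + 1) this
  unfold rank
  omega

/-- Chains of single-factor copies move left, preserve the string and never raise the rank.
Normalization keeps them from running into a repetition factor. -/
theorem Refs.singleLab_spec (hR : Refs F ty i j D) (hN : Normalized F ty i j)
    {k : ℕ} (hk : k < F.length) (hB : ¬ (Long F k ∧ ty k = .B)) :
    ∃ x y, singleLab F ty i j k = (x, y) ∧ IsMain F ty i j x y ∧ (y ≤ k ∨ x = k ∧ y = k + 1) ∧
      seg F x y = seg F k (k + 1) ∧ rank F D x y ≤ rank F D k (k + 1) := by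
  classical
  induction k using Nat.strong_induction_on with
  | _ k ih =>
    have hnode : Node (IsRef F ty i j) 0 F.length k (k + 1) := .single (Nat.zero_le k) hk
    by_cases hl : Long F k
    · by_cases hty : ty k = .A
      · have hlt := hR.lt k hl
        have hc := hR.copy k hl hty
        have hg := hR.isGood_ref hN hl
        have hrk := hR.rank_ref_lt hl
        rw [← seg_single F hk] at hc
        by_cases hs : i k + 1 = j k
        · have hik : i k < k := by omega
          obtain ⟨x, y, h1, h2, h3, h4, h5⟩ := ih (i k) hik (by omega)
            (fun h => hg.2 ⟨hs.symm, h⟩)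
          rw [singleLab, if_pos hl, if_pos hty, if_pos hs, if_pos hik]
          rw [← hs] at hc hrk
          exact ⟨x, y, h1, h2, by omega, h4.trans hc.2.symm, h5.trans hrk.le⟩
        · rw [singleLab, if_pos hl, if_pos hty, if_neg hs]
          exact ⟨_, _, rfl, ⟨hg, if_neg (fun h => hs h.symm)⟩, .inl hc.1, hc.2.symm, hrk.le⟩
      · have h1 : singleLab F ty i j k = (k, k + 1) := by
          rw [singleLab, if_pos hl, if_neg hty]
        exact ⟨_, _, h1, ⟨⟨hnode, fun h => hB h.2⟩, (if_pos rfl).trans h1⟩, .inr ⟨rfl, rfl⟩, rfl,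
          le_rfl⟩
    · have h1 : singleLab F ty i j k =
          (Nat.find (p := fun l => F.getD l [] = F.getD k []) ⟨k, rfl⟩,
            Nat.find (p := fun l => F.getD l [] = F.getD k []) ⟨k, rfl⟩ + 1) := by
        rw [singleLab, if_neg hl]
      have h2 := Nat.find_spec (p := fun l => F.getD l [] = F.getD k []) ⟨k, rfl⟩
      have h3 := Nat.find_min' (p := fun l => F.getD l [] = F.getD k []) ⟨k, rfl⟩ rfl
      generalize hf : Nat.find (p := fun l => F.getD l [] = F.getD k []) ⟨k, rfl⟩ = f at h1 h2 h3
      have hfl : ¬ Long F f := by rwa [Long, h2]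
      have hfF : f < F.length := by omega
      refine ⟨f, f + 1, h1, ⟨⟨.single (Nat.zero_le f) hfF, fun h => hfl h.2.1⟩,
        (if_pos rfl).trans ?_⟩, by omega, ?_, ?_⟩
      · rw [singleLab, if_neg hfl]
        simp only [h2, hf]
      · rw [seg_single F hfF, seg_single F hk, h2]
      · simp [rank, hR.depth_zero f hfl]

theorem Refs.lab_spec (hR : Refs F ty i j D) (hN : Normalized F ty i j) (hF : F ≠ [])
    {a b : ℕ} (h : IsGood F ty i j a b) :
    ∃ x y, lab F ty i j a b = (x, y) ∧ IsMain F ty i j x y ∧ (y ≤ a ∨ x = a ∧ y = b) ∧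
      seg F x y = seg F a b ∧ rank F D x y ≤ rank F D a b := by
  by_cases hs : b = a + 1
  · subst hs
    rw [lab, if_pos rfl]
    exact hR.singleLab_spec hN (by have := h.bounds hF; omega) (fun h' => h.2 ⟨rfl, h'⟩)
  · have : lab F ty i j a b = (a, b) := if_neg hs
    exact ⟨a, b, this, ⟨h, this⟩, .inr ⟨rfl, rfl⟩, rfl, le_rfl⟩

theorem isMain_of_node {a b : ℕ} (h : Node (IsRef F ty i j) 0 F.length a b) (hab : a + 1 < b) :
    IsMain F ty i j a b :=
  ⟨⟨h, by omega⟩, if_neg (by omega)⟩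

/-- A copy has its label further left or on a longer interval, and a repetition leaf is not good. -/
theorem Refs.type_of_isMain (hR : Refs F ty i j D) (hN : Normalized F ty i j)
    {a : ℕ} (h : IsMain F ty i j a (a + 1)) (hl : Long F a) : ty a = .C := by
  rcases hty : ty a
  · have h1 : singleLab F ty i j a = (a, a + 1) := by
      have := h.2
      rwa [lab, if_pos rfl] at this
    have hlt := hR.lt a hl
    have hc := hR.copy a hl hty
    have hg := hR.isGood_ref hN hl
    rw [singleLab, if_pos hl, if_pos hty] at h1
    by_cases hs : i a + 1 = j a
    · rw [if_pos hs, if_pos (by omega)] at h1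
      obtain ⟨x, y, h2, -, h3, -⟩ := hR.singleLab_spec hN (k := i a) (by omega)
        (fun h => hg.2 ⟨hs.symm, h⟩)
      rw [h2, Prod.mk.injEq] at h1
      omega
    · rw [if_neg hs, Prod.mk.injEq] at h1
      omega
  · exact absurd ⟨rfl, hl, hty⟩ h.1.2
  · rfl

/-- The reference `[i k, k)` is the longest possible proper prefix of `[i k, k + 1)`, so the
children are exactly base and power. -/
theorem Refs.split_rep (hR : Refs F ty i j D) {k : ℕ} (hl : Long F k) (hty : ty k = .B) :
    i k + 1 < k + 1 ∧ split (IsRef F ty i j) (i k) (k + 1) = k := by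
  have h1 := hR.lt k hl
  have h2 := (hR.rep k hl hty).1
  have h3 := le_split (R := IsRef F ty i j) (a := i k) (b := k + 1) (c := k) (by omega) (by omega)
    ⟨k, hl, rfl, .inl h2.symm⟩
  have h4 := split_spec (R := IsRef F ty i j) (a := i k) (b := k + 1) (by omega)
  exact ⟨by omega, by omega⟩

theorem Refs.isGood_rep (hR : Refs F ty i j D) (hN : Normalized F ty i j)
    {k : ℕ} (hl : Long F k) (hty : ty k = .B) : IsGood F ty i j (i k) k := by
  have := hR.isGood_ref hN hl
  rwa [(hR.rep k hl hty).1] at this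

/-- If the left child were the leaf of a repetition factor `a`, the node `[i a, a + 1)` would cross
`[a, b)`. -/
theorem Refs.isGood_left (hR : Refs F ty i j D) (hF : F ≠ []) {a b : ℕ}
    (h : Node (IsRef F ty i j) 0 F.length a b) (hab : a + 1 < b) :
    IsGood F ty i j a (split (IsRef F ty i j) a b) := by
  refine ⟨h.trans (.left hab (.refl _ _)), ?_⟩
  rintro ⟨h1, h2, h3⟩
  have h4 := hR.split_rep h2 h3
  have hs := split_spec (R := IsRef F ty i j) hab
  rcases h.cases (List.length_pos_iff.mpr hF) (hR.node_of_isRef ⟨a, h2, rfl, .inr ⟨h3, rfl⟩⟩)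
    with h | h | h | ⟨-, h | h⟩
  · omega
  · omega
  · omega
  · have := h.bounds hs.1; omega
  · have := h.bounds hs.2.1; omega

/-- If the right child is the leaf of a repetition factor `k`, the nodes `[a, b)` and `[i k, k + 1)`
share their right end and both split at `k`; hence they coincide, which `hB` excludes. -/
theorem Refs.isGood_right (hR : Refs F ty i j D) (hF : F ≠ []) {a b : ℕ}
    (h : Node (IsRef F ty i j) 0 F.length a b) (hab : a + 1 < b)
    (hB : ∀ k, b = k + 1 → Long F k → ty k = .B → i k ≠ a) :
    IsGood F ty i j (split (IsRef F ty i j) a b) b := by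
  refine ⟨h.trans (.right hab (.refl _ _)), ?_⟩
  generalize hk : split (IsRef F ty i j) a b = k
  rintro ⟨rfl, h2, h3⟩
  have h4 := hR.split_rep h2 h3
  have h5 := hB k rfl h2 h3
  have hs := split_spec (R := IsRef F ty i j) hab
  have hpos := List.length_pos_iff.mpr hF
  have hr := hR.node_of_isRef ⟨k, h2, rfl, .inr ⟨h3, rfl⟩⟩
  rcases h.cases hpos hr with h' | h' | h' | ⟨-, h' | h'⟩
  · rcases hr.cases hpos h with h | h | h | ⟨-, h | h⟩
    · omega
    · omega
    · omega
    · have := h.bounds (by omega); omega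
    · have := h.bounds (by omega); omega
  · omega
  · omega
  · have := h'.bounds hs.1; omega
  · have := h'.bounds hs.2.1; omega

/-- The rule of the nonterminal of the node `[a, b)`, where `num a b` is the nonterminal of
`[a, b)`. -/
inductive RuleSpec {N : Type*} (F : List (List α)) (ty : ℕ → FactorType) (i j : ℕ → ℕ)
    (num : ℕ → ℕ → N) : ℕ → ℕ → Rule α N → Prop
  | atom (a : ℕ) (c : α) : ¬ Long F a → F.getD a [] = [c] →
      RuleSpec F ty i j num a (a + 1) (.atom c)
  -- Positions count from `1`, so the occurrence after the prefix `s` starts at `s.length + 1`.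
  | trunc (a : ℕ) (s t : List α) : Long F a → ty a = .C →
      s ++ F.getD a [] ++ t = seg F (i a) (j a) →
      RuleSpec F ty i j num a (a + 1)
        (.trunc (num (i a) (j a)) (s.length + 1) (s.length + 1 + (F.getD a []).length))
  | rep (k r : ℕ) : Long F k → ty k = .B → 3 ≤ r →
      F.getD k [] = power (seg F (i k) k) (r - 1) →
      RuleSpec F ty i j num (i k) (k + 1) (.rep (num (i k) k) r)
  | concat (a b : ℕ) : a + 1 < b → (∀ k, b = k + 1 → Long F k → ty k = .B → i k ≠ a) →
      RuleSpec F ty i j num a b (.concat (num a (split (IsRef F ty i j) a b))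
        (num (split (IsRef F ty i j) a b) b))

theorem Refs.exists_ruleSpec {N : Type*} (hR : Refs F ty i j D) (hN : Normalized F ty i j)
    (hF : F ≠ []) (hne : ∀ w ∈ F, w ≠ []) (num : ℕ → ℕ → N) {a b : ℕ}
    (h : IsMain F ty i j a b) : ∃ ρ : Rule α N, RuleSpec F ty i j num a b ρ := by
  have hb := h.1.bounds hF
  by_cases hs : b = a + 1
  · subst hs
    by_cases hl : Long F a
    · have hC := hR.type_of_isMain hN h hl
      obtain ⟨-, s, t, hst⟩ := hR.trunc a hl hC
      exact ⟨_, .trunc a s t hl hC hst⟩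
    · have hlt : a < F.length := by omega
      have h1 := List.length_pos_iff.mpr (hne _ (List.getElem_mem hlt))
      rw [← List.getD_eq_getElem _ [] hlt] at h1
      obtain ⟨c, hc⟩ := List.length_eq_one_iff.mp (show (F.getD a []).length = 1 by
        unfold Long at hl; omega)
      exact ⟨_, .atom a c hl hc⟩
  · by_cases hB : ∀ k, b = k + 1 → Long F k → ty k = .B → i k ≠ a
    · exact ⟨_, .concat a b (by omega) hB⟩
    · push Not at hB
      obtain ⟨k, rfl, hl, hty, rfl⟩ := hB
      obtain ⟨h1, r, hr, h2⟩ := hR.rep k hl hty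
      rw [h1] at h2
      exact ⟨_, .rep k r hl hty hr h2⟩

theorem Refs.exists_of_refersTo {N : Type*} (hR : Refs F ty i j D) (hN : Normalized F ty i j)
    (hF : F ≠ []) {num : ℕ → ℕ → N} {a b : ℕ} (h : IsMain F ty i j a b) {ρ : Rule α N}
    (hρ : RuleSpec F ty i j num a b ρ) {Y : N} (hY : ρ.RefersTo Y) :
    ∃ c d, IsGood F ty i j c d ∧ rank F D c d < rank F D a b ∧ Y = num c d := by
  cases hρ with
  | atom a c => exact hY.elim
  | trunc a s t hl hty => exact ⟨_, _, hR.isGood_ref hN hl, hR.rank_ref_lt hl, hY⟩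
  | rep k r hl hty =>
    refine ⟨_, _, hR.isGood_rep hN hl hty, rank_lt_of_subset le_rfl (by omega) ?_, hY⟩
    have := (hR.split_rep hl hty).1
    omega
  | concat a b hab hB =>
    have hs := split_spec (R := IsRef F ty i j) hab
    rcases hY with rfl | rfl
    · exact ⟨_, _, hR.isGood_left hF h.1.1 hab, rank_lt_of_subset (by omega) (by omega)
        (by omega), rfl⟩
    · exact ⟨_, _, hR.isGood_right hF h.1.1 hab hB, rank_lt_of_subset (by omega) (by omega)
        (by omega), rfl⟩

end Labelling

/-! ### Numbering the nonterminals by rank. -/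

theorem exists_equiv_fin_of_rank {P : Type*} [Finite P] (f : P → ℕ) :
    ∃ (m : ℕ) (e : P ≃ Fin m), ∀ p q, f p < f q → e p < e q := by
  obtain ⟨m, ⟨e₀⟩⟩ := Finite.exists_equiv_fin P
  refine ⟨m, e₀.trans (Tuple.sort (f ∘ e₀.symm)).symm, fun p q hpq => ?_⟩
  by_contra hcon
  have := Tuple.monotone_sort (f ∘ e₀.symm) (not_lt.mp hcon)
  simp at this
  omega

/-- The rule set `G`, in which `num a b` is the nonterminal of `[a, b)`, is the one given by a
reference structure. -/
structure Realizes (F : List (List α)) (ty : ℕ → FactorType) (i j : ℕ → ℕ) (G : RuleSet α)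
    (num : ℕ → ℕ → Fin G.m) : Prop where
  start : G.start = num 0 F.length
  surj : ∀ X, ∃ a b, IsMain F ty i j a b ∧ num a b = X
  inj : ∀ a b x y, IsMain F ty i j a b → IsMain F ty i j x y → num a b = num x y → a = x ∧ b = y
  num_lab : ∀ a b x y, IsGood F ty i j a b → lab F ty i j a b = (x, y) → num x y = num a b
  rule : ∀ a b, IsMain F ty i j a b → RuleSpec F ty i j num a b (G.rule (num a b))

theorem Refs.exists_realizes {F : List (List α)} {ty : ℕ → FactorType} {i j D : ℕ → ℕ}
    (hR : Refs F ty i j D) (hN : Normalized F ty i j) (hF : F ≠ []) (hne : ∀ w ∈ F, w ≠ []) :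
    ∃ (G : RuleSet α) (num : ℕ → ℕ → Fin G.m), Realizes F ty i j G num := by
  classical
  let P := {p : ℕ × ℕ // IsMain F ty i j p.1 p.2}
  have : Finite P := by
    refine Set.Finite.to_subtype ((Set.finite_Iic (F.length, F.length)).subset fun p hp => ?_)
    have hb := hp.1.bounds hF
    exact Set.mem_Iic.mpr ⟨by simp only; omega, hb.2⟩
  obtain ⟨m, e, he⟩ := exists_equiv_fin_of_rank (fun p : P => rank F D p.1.1 p.1.2)
  obtain ⟨x₀, y₀, h₀, hm₀, -⟩ := hR.lab_spec hN hF hR.isGood_root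
  -- The label of a good interval is always main; the nonterminal of the root is a default that
  -- makes `num` total.
  let num : ℕ → ℕ → Fin m := fun a b =>
    if h : IsMain F ty i j (lab F ty i j a b).1 (lab F ty i j a b).2 then e ⟨_, h⟩
    else e ⟨(x₀, y₀), hm₀⟩
  have hnum : ∀ a b x y, lab F ty i j a b = (x, y) → ∀ h : IsMain F ty i j x y,
      num a b = e ⟨(x, y), h⟩ := by
    intro a b x y hxy h
    simp only [num, hxy, h, dif_pos]
  have hmain : ∀ a b, ∀ h : IsMain F ty i j a b, num a b = e ⟨(a, b), h⟩ :=
    fun a b h => hnum a b a b h.2 h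
  choose rule hrule using fun p : P => hR.exists_ruleSpec hN hF hne num p.2
  refine ⟨⟨m, fun X => rule (e.symm X), num 0 F.length, ?_⟩, num, rfl, ?_, ?_, ?_, ?_⟩
  · intro X Y hY
    obtain ⟨c, d, hg, hlt, rfl⟩ := hR.exists_of_refersTo hN hF (e.symm X).2 (hrule _) hY
    obtain ⟨x, y, hxy, hm, -, -, hle⟩ := hR.lab_spec hN hF hg
    rw [hnum c d x y hxy hm]
    have := he ⟨(x, y), hm⟩ (e.symm X) (hle.trans_lt hlt)
    rwa [e.apply_symm_apply] at this
  · intro X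
    exact ⟨_, _, (e.symm X).2, by rw [hmain _ _ (e.symm X).2]; exact e.apply_symm_apply X⟩
  · intro a b x y h h' heq
    rw [hmain a b h, hmain x y h'] at heq
    have := congrArg Subtype.val (e.injective heq)
    exact ⟨congrArg Prod.fst this, congrArg Prod.snd this⟩
  · intro a b x y h hxy
    obtain ⟨x', y', hxy', hm, -⟩ := hR.lab_spec hN hF h
    obtain ⟨rfl, rfl⟩ := Prod.mk.inj (hxy.symm.trans hxy')
    rw [hmain x y hm, hnum a b x y hxy hm]
  · intro a b h
    have := hrule ⟨(a, b), h⟩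
    simp only
    rw [hmain a b h, e.symm_apply_apply]
    exact this

/-! ### Reachable nonterminals -/

/-- The starting nonterminal can be expanded, without truncation rules, to a sequence that
contains `X`. -/
def RuleSet.Reach (G : RuleSet α) (X : Fin G.m) : Prop :=
  ∃ w : List (α ⊕ Fin G.m), Relation.ReflTransGen G.Step [Sum.inr G.start] w ∧ Sum.inr X ∈ w

section Reach

variable {G : RuleSet α} {X Y Z : Fin G.m}

theorem RuleSet.reach_start : G.Reach G.start := ⟨_, .refl, by simp⟩

theorem RuleSet.Reach.concat (h : G.Reach X) (hX : G.rule X = .concat Y Z) :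
    G.Reach Y ∧ G.Reach Z := by
  obtain ⟨w, hw, hXw⟩ := h
  obtain ⟨u, v, rfl⟩ := List.append_of_mem hXw
  have := hw.tail (b := u ++ Sum.inr X :: v) (by
    have := Step.concat u v X Y Z hX
    rwa [List.append_assoc, List.singleton_append] at this)
  exact ⟨⟨_, this, by simp⟩, ⟨_, this, by simp⟩⟩

theorem RuleSet.Reach.rep {r : ℕ} (h : G.Reach X) (hX : G.rule X = .rep Y r) (hr : 0 < r) :
    G.Reach Y := by
  obtain ⟨w, hw, hXw⟩ := h
  obtain ⟨u, v, rfl⟩ := List.append_of_mem hXw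
  have := hw.tail (b := u ++ Sum.inr X :: v) (by
    have := Step.rep u v X Y r hX
    rwa [List.append_assoc u, List.singleton_append] at this)
  exact ⟨_, this, by simp [hr.ne']⟩

/-- Each new symbol of an expansion step is referred to by the rule applied, so internality already
rules out useless nonterminals. -/
theorem RuleSet.Reach.reflTransGen (h : G.Reach X) :
    Relation.ReflTransGen (fun V W => (G.rule V).RefersTo W) G.start X := by
  obtain ⟨w, hw, hX⟩ := h
  induction hw generalizing X with
  | refl =>
    simp only [List.mem_singleton, Sum.inr.injEq] at hX
    exact hX ▸ .refl
  | tail _ hs ih =>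
    cases hs with
    | atom u v V a h =>
      refine ih ?_
      simp only [List.mem_append, List.mem_singleton, reduceCtorEq, or_false] at hX ⊢
      tauto
    | concat u v V Y Z h =>
      have hV := ih (X := V) (by simp)
      simp only [List.mem_append, List.mem_cons, Sum.inr.injEq, List.not_mem_nil, or_false] at hX ih
      rcases hX with (hX | rfl | rfl) | hX
      · exact ih (by tauto)
      · exact hV.tail (by simp [h, Rule.RefersTo])
      · exact hV.tail (by simp [h, Rule.RefersTo])
      · exact ih (by tauto)
    | rep u v V Y r h =>
      have hV := ih (X := V) (by simp)
      simp only [List.mem_append, List.mem_replicate, Sum.inr.injEq, List.mem_singleton] at hX ih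
      rcases hX with (hX | ⟨-, rfl⟩) | hX
      · exact ih (by tauto)
      · exact hV.tail (by simp [h, Rule.RefersTo])
      · exact ih (by tauto)

end Reach

/-! ### The grammar tree given by a reference structure -/

section Backward

variable {F : List (List α)} {ty : ℕ → FactorType} {i j D : ℕ → ℕ} {G : RuleSet α}
  {num : ℕ → ℕ → Fin G.m}

/-- The induction is on the nonterminal, not on the interval, because truncations refer to intervals
elsewhere in the text. -/
theorem Realizes.expand_num (hG : Realizes F ty i j G num) (hR : Refs F ty i j D)
    (hN : Normalized F ty i j) (hF : F ≠ []) {a b : ℕ} (h : IsGood F ty i j a b) :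
    G.expand (num a b) = seg F a b := by
  generalize hX : num a b = X
  induction X using WellFoundedLT.induction generalizing a b with
  | ind X ih =>
    obtain ⟨x, y, hxy, hm, -, hseg, -⟩ := hR.lab_spec hN hF h
    rw [← hG.num_lab a b x y h hxy] at hX
    rw [← hseg]
    clear hxy hseg h
    subst hX
    have hb := hm.1.bounds hF
    have hρ := hG.rule x y hm
    generalize hr : G.rule (num x y) = ρ at hρ
    have hlt : ∀ Y, ρ.RefersTo Y → Y < num x y := fun Y hY => G.refers_lt _ _ (hr ▸ hY)
    cases hρ with
    | atom a c hl hc =>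
      rw [RuleSet.expand_atom hr, seg_single F (by omega), hc]
    | trunc a s t hl hty hst =>
      rw [RuleSet.expand_trunc hr, ih _ (hlt _ rfl) (hR.isGood_ref hN hl) rfl,
        seg_single F (by omega), ← hst]
      simp [substr]
    | rep k r hl hty hr3 hk =>
      have hs := hR.split_rep hl hty
      rw [RuleSet.expand_rep hr, ih _ (hlt _ rfl) (hR.isGood_rep hN hl hty) rfl,
        power_pred _ hr3, ← hk, ← seg_single F hl.lt_length, seg_append F (by omega) (by omega)]
    | concat a b hab hB =>
      have hs := split_spec (R := IsRef F ty i j) hab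
      rw [RuleSet.expand_concat hr, ih _ (hlt _ (.inl rfl)) (hR.isGood_left hF hm.1.1 hab) rfl,
        ih _ (hlt _ (.inr rfl)) (hR.isGood_right hF hm.1.1 hab hB) rfl,
        seg_append F hs.1.le hs.2.1.le]

/-- Follow the tree path from the root: every inner node has a concatenation or repetition rule, and
truncations sit only at leaves. -/
theorem Realizes.reach (hG : Realizes F ty i j G num) (hR : Refs F ty i j D)
    (X : Fin G.m) : G.Reach X := by
  have key : ∀ a b x y, Node (IsRef F ty i j) a b x y → Node (IsRef F ty i j) 0 F.length a b →
      (IsGood F ty i j a b → G.Reach (num a b)) → IsGood F ty i j x y → G.Reach (num x y) := by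
    intro a b x y h
    induction h with
    | refl => exact fun _ h h' => h h'
    | @left a b x y hab h ih =>
      intro hn ha
      refine ih (hn.trans (.left hab (.refl _ _))) fun _ => ?_
      have hm := isMain_of_node hn hab
      have hr := ha hm.1
      have hρ := hG.rule a b hm
      clear ih h ha
      generalize hrule : G.rule (num a b) = ρ at hρ
      cases hρ with
      | atom => omega
      | trunc => omega
      | rep k r hl hty hr3 =>
        rw [(hR.split_rep hl hty).2]
        exact hr.rep hrule (by omega)
      | concat => exact (hr.concat hrule).1
    | @right a b x y hab h ih =>
      intro hn ha
      refine ih (hn.trans (.right hab (.refl _ _))) fun hgood => ?_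
      have hm := isMain_of_node hn hab
      have hr := ha hm.1
      have hρ := hG.rule a b hm
      clear ih h ha
      generalize hrule : G.rule (num a b) = ρ at hρ
      cases hρ with
      | atom => omega
      | trunc => omega
      -- The right child of a repetition is the leaf of a power, which is not good, so nothing has
      -- to be reached.
      | rep k r hl hty =>
        rw [(hR.split_rep hl hty).2] at hgood
        exact absurd ⟨rfl, hl, hty⟩ hgood.2
      | concat => exact (hr.concat hrule).2
  obtain ⟨a, b, hm, rfl⟩ := hG.surj X
  exact key _ _ a b hm.1.1 (.refl _ _) (fun _ => hG.start ▸ RuleSet.reach_start) hm.1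

/-- Passing to a label never moves the right end to the right, and the parse tree does not descend
into the referents of truncations. Hence nothing below a node is labelled by a main node ending
later. -/
theorem Realizes.le_of_mem_labels (hG : Realizes F ty i j G num) (hR : Refs F ty i j D)
    (hN : Normalized F ty i j) (hF : F ≠ []) {a b p q : ℕ} (h : IsGood F ty i j a b)
    (hpq : IsMain F ty i j p q)
    (hp : Label.nonterm (num p q) ∈ (G.parseTree (num a b)).labels) : q ≤ b := by
  generalize hX : num a b = X at hp
  induction X using WellFoundedLT.induction generalizing a b with
  | ind X ih =>
    obtain ⟨x, y, hxy, hm, hle, -, -⟩ := hR.lab_spec hN hF h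
    rw [← hG.num_lab a b x y h hxy] at hX
    have hb := h.bounds hF
    refine le_trans ?_ (show y ≤ b by omega)
    clear hxy hle h hb
    subst hX
    have hρ := hG.rule x y hm
    generalize hr : G.rule (num x y) = ρ at hρ
    have hlt : ∀ Y, ρ.RefersTo Y → Y < num x y := fun Y hY => G.refers_lt _ _ (hr ▸ hY)
    have hself : num p q = num x y → q ≤ y := fun h => (hG.inj _ _ _ _ hpq hm h).2.le
    cases hρ with
    | atom a c hl hc =>
      exact hself ((RuleSet.mem_labels_atom hr).mp hp)
    | trunc a s t hl hty hst =>
      exact hself ((RuleSet.mem_labels_trunc hr).mp hp)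
    | rep k r hl hty hr3 hk =>
      rcases (RuleSet.mem_labels_rep hr).mp hp with hp | hp
      · exact hself hp
      · have := ih _ (hlt _ rfl) (hR.isGood_rep hN hl hty) rfl hp
        omega
    | concat a b hab hB =>
      have hs := split_spec (R := IsRef F ty i j) hab
      rcases (RuleSet.mem_labels_concat hr).mp hp with hp | hp | hp
      · exact hself hp
      · have := ih _ (hlt _ (.inl rfl)) (hR.isGood_left hF hm.1.1 hab) rfl hp
        omega
      · exact ih _ (hlt _ (.inr rfl)) (hR.isGood_right hF hm.1.1 hab hB) rfl hp

theorem Realizes.mem_labels (hG : Realizes F ty i j G num) (hR : Refs F ty i j D)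
    {a b p q : ℕ} (h : Node (IsRef F ty i j) a b p q)
    (hab : Node (IsRef F ty i j) 0 F.length a b) (hpq : IsMain F ty i j p q) :
    Label.nonterm (num p q) ∈ (G.parseTree (num a b)).labels := by
  induction h with
  | refl => exact RuleSet.mem_labels_self _
  | @left a b x y hlt h ih =>
    have hin := ih (hab.trans (.left hlt (.refl _ _))) hpq
    have hρ := hG.rule a b (isMain_of_node hab hlt)
    clear ih h
    generalize hrule : G.rule (num a b) = ρ at hρ
    cases hρ with
    | atom => omega
    | trunc => omega
    | rep k r hl hty hr3 =>
      rw [(hR.split_rep hl hty).2] at hin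
      exact (RuleSet.mem_labels_rep hrule).mpr (.inr hin)
    | concat => exact (RuleSet.mem_labels_concat hrule).mpr (.inr (.inl hin))
  | @right a b x y hlt h ih =>
    have hin := ih (hab.trans (.right hlt (.refl _ _))) hpq
    have hρ := hG.rule a b (isMain_of_node hab hlt)
    clear ih
    generalize hrule : G.rule (num a b) = ρ at hρ
    cases hρ with
    | atom => omega
    | trunc => omega
    | rep k r hl hty =>
      rw [(hR.split_rep hl hty).2] at h
      have hb := h.bounds (Nat.lt_succ_self k)
      obtain rfl : x = k := by omega
      obtain rfl : y = x + 1 := by omega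
      exact absurd ⟨rfl, hl, hty⟩ hpq.1.2
    | concat => exact (RuleSet.mem_labels_concat hrule).mpr (.inr (.inr hin))

/-- `S` contains just the nonterminals of the nodes that end at `a` or before. -/
def LeftLabels (F : List (List α)) (ty : ℕ → FactorType) (i j : ℕ → ℕ) (G : RuleSet α)
    (num : ℕ → ℕ → Fin G.m) (S : Set (Label α (Fin G.m))) (a : ℕ) : Prop :=
  ∀ p q, IsMain F ty i j p q → (Label.nonterm (num p q) ∈ S ↔ q ≤ a)

/-- A main node ending after `a` but not after the split can only be below the left child, and
nothing in the left child's parse tree ends later than the split. -/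
theorem Realizes.leftLabels_union (hG : Realizes F ty i j G num) (hR : Refs F ty i j D)
    (hN : Normalized F ty i j) (hF : F ≠ []) {a b : ℕ}
    (h : Node (IsRef F ty i j) 0 F.length a b) (hab : a + 1 < b) {S : Set (Label α (Fin G.m))}
    (hS : LeftLabels F ty i j G num S a) :
    LeftLabels F ty i j G num
      (S ∪ (G.parseTree (num a (split (IsRef F ty i j) a b))).labels)
      (split (IsRef F ty i j) a b) := by
  intro p q hpq
  have hs := split_spec (R := IsRef F ty i j) hab
  rw [Set.mem_union, hS p q hpq]
  constructor
  · rintro (hq | hq)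
    · omega
    · exact hG.le_of_mem_labels hR hN hF (hR.isGood_left hF h hab) hpq hq
  · intro hq
    by_cases hqa : q ≤ a
    · exact .inl hqa
    · refine .inr ?_
      have hleft : Node (IsRef F ty i j) 0 F.length a (split (IsRef F ty i j) a b) :=
        h.trans (.left hab (.refl _ _))
      rcases h.cases (List.length_pos_iff.mpr hF) hpq.1.1 with h' | h' | h' | ⟨-, h' | h'⟩
      · omega
      · have := hpq.1.bounds hF; omega
      · omega
      · exact hG.mem_labels hR h' hleft hpq
      · have := h'.bounds hs.2.1; omega

/-- The invariant `LeftLabels` makes pruning stop exactly at the single factors whose label lies to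
the left; inner nodes end after `a` and are never pruned. -/
theorem Realizes.leaves_prune (hG : Realizes F ty i j G num) (hR : Refs F ty i j D)
    (hN : Normalized F ty i j) (hF : F ≠ []) {a b : ℕ} (h : IsGood F ty i j a b)
    {S : Set (Label α (Fin G.m))} (hS : LeftLabels F ty i j G num S a) :
    ((G.parseTree (num a b)).prune S).leaves.map G.labelString = (F.drop a).take (b - a) := by
  induction hn : b - a using Nat.strong_induction_on generalizing a b S with
  | _ n ih =>
    subst hn
    have hb := h.bounds hF
    by_cases hs : b = a + 1
    · subst hs
      have hexp := hG.expand_num hR hN hF h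
      rw [seg_single F (by omega)] at hexp
      rw [drop_take_single F (by omega), ← hexp]
      obtain ⟨x, y, hxy, hm, hle, -, -⟩ := hR.lab_spec hN hF h
      have hnum := hG.num_lab _ _ x y h hxy
      rcases hle with hle | ⟨rfl, rfl⟩
      -- The label ends at or before `a`, so the node is pruned to a leaf deriving the factor.
      · rw [← hnum, RuleSet.prune_of_mem ((hS x y hm).mpr hle)]
        simp [LTree.leaves, RuleSet.labelString]
      · have hXS : Label.nonterm (num x (x + 1)) ∉ S := by rw [hS _ _ hm]; omega
        have hρ := hG.rule x _ hm
        clear hnum hxy hexp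
        generalize hy : x + 1 = y at *
        generalize hrule : G.rule (num x y) = ρ at hρ
        cases hρ with
        | atom a c =>
          rw [RuleSet.prune_atom hrule hXS, RuleSet.expand_atom hrule]
          simp [LTree.leaves, RuleSet.labelString]
        | trunc =>
          rw [RuleSet.prune_trunc hrule hXS, RuleSet.expand_trunc hrule]
          simp [LTree.leaves, RuleSet.labelString]
        | rep k r hl hty => have := hR.split_rep hl hty; omega
        | concat => omega
    · have hab : a + 1 < b := by omega
      have hm := isMain_of_node h.1 hab
      have hsp := split_spec (R := IsRef F ty i j) hab
      have hXS : Label.nonterm (num a b) ∉ S := by rw [hS _ _ hm]; omega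
      have hleft := ih _ (by omega) (hR.isGood_left hF h.1 hab) hS rfl
      have hright := fun hg : IsGood F ty i j (split (IsRef F ty i j) a b) b =>
        ih _ (by omega) hg (hG.leftLabels_union hR hN hF h.1 hab hS) rfl
      rw [← drop_take_append F hsp.1.le hsp.2.1.le, ← hleft]
      have hρ := hG.rule a b hm
      clear ih hleft
      generalize hrule : G.rule (num a b) = ρ at hρ
      cases hρ with
      | atom => omega
      | trunc => omega
      | rep k r hl hty hr3 hk =>
        rw [(hR.split_rep hl hty).2, RuleSet.prune_rep hrule hXS, LTree.leaves, List.map_append,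
          drop_take_single F hl.lt_length, hk, ← hG.expand_num hR hN hF (hR.isGood_rep hN hl hty)]
        simp [LTree.leaves, RuleSet.labelString]
      | concat a b hab hB =>
        rw [RuleSet.prune_concat hrule hXS, LTree.leaves, List.map_append,
          hright (hR.isGood_right hF h.1 hab hB)]

theorem Refs.isICSFactorization (hR : Refs F ty i j D) (hF : F ≠ []) (hne : ∀ w ∈ F, w ≠ []) :
    IsICSFactorization F.flatten F := by
  obtain ⟨ty, i, hR, hN⟩ := hR.exists_normalized
  obtain ⟨G, num, hG⟩ := hR.exists_realizes hN hF hne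
  have hroot := hR.isGood_root
  refine ⟨⟨G, ?_, ?_, fun X => (hG.reach hR X).reflTransGen⟩, hG.reach hR, ?_, ?_⟩
  · intro X Y r hX
    obtain ⟨a, b, hm, rfl⟩ := hG.surj X
    have hρ := hG.rule a b hm
    rw [hX] at hρ
    cases hρ with
    | rep k r hl hty hr => exact hr
  · intro X Y b e hX
    obtain ⟨a, b, hm, rfl⟩ := hG.surj X
    have hρ := hG.rule a b hm
    rw [hX] at hρ
    cases hρ with
    | trunc a s t hl hty hst =>
      have := congrArg List.length hst
      rw [hG.expand_num hR hN hF (hR.isGood_ref hN hl)]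
      simp only [List.length_append] at this
      unfold Long at hl
      omega
  · simp only
    rw [hG.start, hG.expand_num hR hN hF hroot, seg_full]
  · rw [RuleSet.leafStrings, RuleSet.grammarTree]
    simp only
    rw [hG.start, hG.leaves_prune hR hN hF hroot]
    · simp
    · intro p q hpq
      have := hpq.1.bounds hF
      simp only [Set.mem_empty_iff_false, false_iff]
      omega

end Backward

end Collage

theorem mainTheorem4 {α : Type*} (T : List α) (F : List (List α)) (hT : T = F.flatten)
    (hF : F ≠ []) (hne : ∀ w ∈ F, w ≠ []) :
    Collage.IsICSFactorization T F ↔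
      ∃ (ty : Fin F.length → Collage.FactorType) (i j : Fin F.length → Fin F.length),
        (∀ k, 1 < F[k].length → Collage.Matches T F k (i k) (j k) (ty k)) ∧
        Collage.Laminar (Collage.inducedIntervals F ty i j) ∧
        ∃ D : Fin F.length → ℤ, Collage.IsReferenceDepth F i j D := by
  constructor
  · rintro ⟨G, hG, -, rfl⟩
    obtain ⟨ty, i, j, D, hR⟩ := hG.exists_refs
    exact hR.exists_fin hT hne
  · rintro ⟨ty, i, j, hM, hL, D, hD⟩
    obtain ⟨ty, i, j, D, hR⟩ := Collage.exists_refs_of_fin hT hne hM hL hD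
    exact hT ▸ hR.isICSFactorization hF hne
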